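/- **Theorem 3.2.** For positive integers $n,p$, a real $q\in[0,2)$ and $R>0$ let $$\mathcal F_q(R)=\Big\{\Sigma\in\mathbb R^{p\times p}:\ \Sigma \text{ symmetric positive semidefinite},\ \Sigma_{ii}=1\ (1\le i\le p),\ \sum_{i\ne j}|\sigma_{ij}|^q\le R\Big\}$$ (for $q=0$ the sum counts the nonzero off-diagonal entries), let $Q(\Sigma)=\sum_{i\neq j}\sigma_{ij}^2$, and let $\mathbb E_\Sigma$ be the expectation when $X_1,\dots,X_n$ are i.i.d. $\mathcal N(0,\Sigma)$ in $\mathbb R^p$. Put $$\rho_{n,p}(q,R)=R^2\Big(\frac{\log\big(\frac{p-1}{R^2n^q}+1\big)}{2n}\Big)^{2-q}\wedge R^{4/q}\wedge 1,\qquad \phi_{n,p}(q,R)=\frac{R^2}{n}\vee\rho_{n,p}(q,R)$$ (for $q=0$ the term $R^{4/q}$ is omitted). Fix $q\in[0,2)$. Below, $R$, $n$, $p$ are always assumed to satisfy $$2\log p<n,\qquad R^2<\tfrac12(p-1)n^{-q},\qquad\text{and } R\ge 2 \text{ if } q=0 .$$ 1. For every $R_0>0$ there is a constant $C_3>0$,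 depending only on $q$ and $R_0$, such that for all such $n,p$ and all such $R\ge R_0$ $$\inf_{\hat Q}\ \sup_{\Sigma\in\mathcal F_q(R)}\mathbb E_\Sigma\big[(\hat Q-Q(\Sigma))^2\big]\ \ge\ C_3\,\phi_{n,p}(q,R).$$ In particular, for each fixed $R$ this holds with a constant depending only on $q$ and $R$. 2. There is a constant $C_3>0$, depending only on $q$, such that for all such $n,p$ and all such $R>0$ $$\inf_{\hat Q}\ \sup_{\Sigma\in\mathcal F_q(R)}\mathbb E_\Sigma\big[(\hat Q-Q(\Sigma))^2\big]\ \ge\ C_3\,\rho_{n,p}(q,R).$$ The infima are over all real-valued measurable functions $\hat Q$ of the sample $X_1,\dots,X_n$. -/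

import Mathlib

open MeasureTheory ProbabilityTheory
open scoped ENNReal

namespace SparseCov

noncomputable section

/-- The off-diagonal quadratic functional `Q(Σ) = ∑_{i ≠ j} σ_{ij}²`. -/
def offDiagQuad {p : ℕ} (S : Matrix (Fin p) (Fin p) ℝ) : ℝ :=
  ∑ x ∈ (Finset.univ : Finset (Fin p)).offDiag, S x.1 x.2 ^ 2

/-- The off-diagonal sparsity `∑_{i ≠ j} |σ_{ij}| ^ q`, with the usual convention that a vanishing
entry contributes `0` also when `q = 0` (so that `q = 0` counts the nonzero entries). -/
def offDiagSparsity {p : ℕ} (q : ℝ) (S : Matrix (Fin p) (Fin p) ℝ) : ℝ :=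
  ∑ x ∈ (Finset.univ : Finset (Fin p)).offDiag, if S x.1 x.2 = 0 then 0 else |S x.1 x.2| ^ q

/-- The class `F_q(R)` of `p × p` correlation matrices with off-diagonal `ℓ_q`-sparsity at most
`R`. -/
def sparseClass (p : ℕ) (q R : ℝ) : Set (Matrix (Fin p) (Fin p) ℝ) :=
  {S | S.PosSemidef ∧ offDiagSparsity q S ≤ R ∧ ∀ i, S i i = 1}

/-- The law of a sample `X_1, …, X_n` of i.i.d. `N(0, Σ)` random vectors in `ℝ^p`. -/
def sampleLaw (n : ℕ) {p : ℕ} (S : Matrix (Fin p) (Fin p) ℝ) :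
    Measure (Fin n → EuclideanSpace ℝ (Fin p)) :=
  Measure.pi fun _ => multivariateGaussian 0 S

/-- The minimax squared risk for estimating `Q(Σ)` over `F_q(R)`: the infimum over all measurable
real functions of the sample of the supremum over `Σ ∈ F_q(R)` of `E_Σ (Q̂ - Q(Σ))²`, as a number
in `[0, ∞]`. -/
def minimaxRisk (n p : ℕ) (q R : ℝ) : ℝ≥0∞ :=
  ⨅ Qhat : {f : (Fin n → EuclideanSpace ℝ (Fin p)) → ℝ // Measurable f},
    ⨆ S ∈ sparseClass p q R,
      ∫⁻ X, ENNReal.ofReal ((Qhat.1 X - offDiagQuad S) ^ 2) ∂(sampleLaw n S)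

/-- The sparse part of the rate,
`R² (log ((p-1)/(R² n^q) + 1) / (2n))^(2-q) ∧ R^(4/q) ∧ 1`.
For `q = 0` and `R ≥ 1` the middle term is to be read as absent; the code is right there too,
since `4 / 0 = 0` turns that term into `1`. -/
def sparseRate (n p : ℕ) (q R : ℝ) : ℝ :=
  min (min (R ^ 2 * (Real.log (((p : ℝ) - 1) / (R ^ 2 * (n : ℝ) ^ q) + 1) / (2 * (n : ℝ)))
    ^ (2 - q)) (R ^ (4 / q))) 1

/-- The rate `φ_{n,p}(q, R) = R²/n ∨ {R² (log(…)/(2n))^(2-q) ∧ R^(4/q) ∧ 1}`. -/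
def rate (n p : ℕ) (q R : ℝ) : ℝ :=
  max (R ^ 2 / (n : ℝ)) (sparseRate n p q R)

end

end SparseCov

/-!
All lower bounds come from Le Cam's method with a simple null and a finite mixture of alternatives
(`minimaxRisk_ge`): if `Q` takes the value `Q₀` under the null, `Q₀ + Δ` under every alternative, and
the likelihood ratio of the uniform mixture has second moment at most `M` under the null, then the
minimax risk is at least `Δ² / (16 M)`.

The observations are realised as linear functions of latent Gaussian variables `(y, x)`, standard
under the null; under an alternative `x` and `y` keep their standard Gaussian laws but acquire the
covariance `v`. Since passing from `(y, x)` to the observations can only lose information, it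
suffices to control the likelihood ratios of the latent variables, whose cross moments are
`1 / (1 - ⟨v, w⟩)` (`lintegral_tilt_mul_tilt`), to the power `n` for a sample. Singular covariance
matrices of the observations are therefore harmless.

* Rate `R² / n`: two blocks of about `√R / 2` perfectly correlated variables each (at least one),
  with cross-correlation `r`, bounded away from `0`, against `r` plus a term of order `1 / √n`. The
  two block variables share a common factor and have specific parts `y₀`, `x`; correlating these parts
  moves the cross-correlation without changing any variance. About `R` entries move, so `Q` changes
  by an amount of order `R / √n`.
* Sparse rate: independence against a covariance matrix in which one variable has covariance `a` with
  `k` of the others. These `k` variables are chosen at random, one from each of `k` disjoint groups,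
  so that the second moment of the mixture factorises over the groups. With
  `a² ≈ log ((p - 1) / (R² n^q) + 1) / (2 n)` and `k ≈ R / (2 a^q)`, up to caps, that second moment is
  bounded, and `Q` changes by `2 k a²`.
-/

namespace SparseCov

/-! ### Le Cam's method for i.i.d. samples -/

lemma lintegral_pi_prod {n : ℕ} {Ω : Type*} [MeasurableSpace Ω] (μ : Measure Ω)
    [IsProbabilityMeasure μ] {h : Fin n → Ω → ℝ≥0∞} (hh : ∀ i, Measurable (h i)) :
    ∫⁻ ω, ∏ i, h i (ω i) ∂(Measure.pi fun _ : Fin n => μ) = ∏ i, ∫⁻ x, h i x ∂μ := by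
  have hind : iIndepFun (fun i (ω : Fin n → Ω) => h i (ω i)) (Measure.pi fun _ : Fin n => μ) :=
    iIndepFun_pi (μ := fun _ : Fin n => μ) (X := h) fun i => (hh i).aemeasurable
  rw [lintegral_prod_eq_prod_lintegral_of_indepFun _ _ hind
    fun i => (hh i).comp (measurable_pi_apply i)]
  refine Finset.prod_congr rfl fun i _ => ?_
  exact (measurePreserving_eval (fun _ : Fin n => μ) i).lintegral_comp (hh i)

lemma pi_withDensity {n : ℕ} {Ω : Type*} [MeasurableSpace Ω] (μ : Measure Ω)
    [IsProbabilityMeasure μ] {f : Ω → ℝ≥0∞} (hf : Measurable f)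
    [IsProbabilityMeasure (μ.withDensity f)] :
    Measure.pi (fun _ : Fin n => μ.withDensity f) =
      (Measure.pi fun _ : Fin n => μ).withDensity fun ω => ∏ i, f (ω i) := by
  refine Measure.pi_eq fun s hs => ?_
  rw [withDensity_apply _ (MeasurableSet.univ_pi hs), ← lintegral_indicator (.univ_pi hs)]
  have : (Set.univ.pi s).indicator (fun ω : Fin n → Ω => ∏ i, f (ω i)) =
      fun ω => ∏ i, (s i).indicator f (ω i) := by
    ext ω
    by_cases h : ω ∈ Set.univ.pi s
    · rw [Set.indicator_of_mem h]
      exact Finset.prod_congr rfl fun i _ => (Set.indicator_of_mem (h i trivial) f).symm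
    · rw [Set.indicator_of_notMem h]
      simp only [Set.mem_pi, not_forall] at h
      obtain ⟨i, _, hi⟩ := h
      exact (Finset.prod_eq_zero (Finset.mem_univ i) (Set.indicator_of_notMem hi f)).symm
  rw [this, lintegral_pi_prod μ fun i => hf.indicator (hs i)]
  exact Finset.prod_congr rfl fun i _ => by
    rw [lintegral_indicator (hs i), withDensity_apply _ (hs i)]

/-- The arithmetic-geometric mean inequality behind the chi-square form of Le Cam's bound. -/
lemma le_sq_div_add {M : ℝ} (hM : 0 < M) (g : ℝ≥0∞) :
    g ≤ ENNReal.ofReal (1 / (4 * M)) * g ^ 2 + ENNReal.ofReal M := by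
  induction g with
  | top => simp [hM, ENNReal.mul_top]
  | coe g =>
    rw [← ENNReal.ofReal_coe_nnreal, ← ENNReal.ofReal_pow g.coe_nonneg,
      ← ENNReal.ofReal_mul (by positivity), ← ENNReal.ofReal_add (by positivity) hM.le]
    refine ENNReal.ofReal_le_ofReal ?_
    have h : 1 / (4 * M) * (g : ℝ) ^ 2 + M - g = (g - 2 * M) ^ 2 / (4 * M) := by
      field_simp; ring
    have : 0 ≤ ((g : ℝ) - 2 * M) ^ 2 / (4 * M) := by positivity
    linarith

/-- **Le Cam's testing bound.** If the mixture `N⁻¹ ∑ f v` of densities with respect to `P` has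
second moment at most `M`, then no test separates `P` from all the alternatives. -/
lemma testing_lower_bound {Ω V : Type*} [MeasurableSpace Ω] [Fintype V] [Nonempty V]
    (P : Measure Ω) {f : V → Ω → ℝ≥0∞} (hf : ∀ v, Measurable (f v))
    (hf1 : ∀ v, ∫⁻ x, f v x ∂P = 1) {M : ℝ} (hM : 1 ≤ M)
    (h2 : ∑ v, ∑ w, ∫⁻ x, f v x * f w x ∂P ≤ ENNReal.ofReal (M * (Fintype.card V : ℝ) ^ 2))
    {A : Set Ω} (hA : MeasurableSet A) :
    ENNReal.ofReal (1 / (4 * M)) ≤ P A ∨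
      ∃ v, ENNReal.ofReal (1 / (4 * M)) ≤ ∫⁻ x in Aᶜ, f v x ∂P := by
  by_contra! hcon
  obtain ⟨hPA, hv⟩ := hcon
  have hM0 : 0 < M := by linarith
  set N : ℝ := (Fintype.card V : ℝ) with hN
  have hNpos : 0 < N := by rw [hN]; exact_mod_cast Fintype.card_pos
  set g : Ω → ℝ≥0∞ := fun x => ENNReal.ofReal N⁻¹ * ∑ v, f v x with hg
  have hgm : Measurable g := by fun_prop
  have hNN : ENNReal.ofReal N⁻¹ * ENNReal.ofReal N = 1 := by
    rw [← ENNReal.ofReal_mul (by positivity), inv_mul_cancel₀ hNpos.ne', ENNReal.ofReal_one]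
  have hcard : ENNReal.ofReal N = (Fintype.card V : ℝ≥0∞) := by
    rw [hN, ENNReal.ofReal_natCast]
  have hg1 : ∫⁻ x, g x ∂P = 1 := by
    rw [lintegral_const_mul _ (by fun_prop), lintegral_finsetSum _ fun v _ => hf v]
    simp [hf1, ← hcard, hNN]
  have hgc : ∫⁻ x in Aᶜ, g x ∂P ≤ ENNReal.ofReal (1 / (4 * M)) := by
    rw [lintegral_const_mul _ (by fun_prop), lintegral_finsetSum _ fun v _ => hf v]
    calc _ ≤ ENNReal.ofReal N⁻¹ * ∑ _v : V, ENNReal.ofReal (1 / (4 * M)) := by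
          gcongr with v; exact (hv v).le
      _ = ENNReal.ofReal (1 / (4 * M)) := by
          rw [Finset.sum_const, nsmul_eq_mul, Finset.card_univ, ← hcard, ← mul_assoc, hNN, one_mul]
  have hg2 : ∫⁻ x, g x ^ 2 ∂P ≤ ENNReal.ofReal M := by
    have : ∀ x, g x ^ 2 = ENNReal.ofReal (N⁻¹ ^ 2) * ∑ v, ∑ w, f v x * f w x := fun x => by
      rw [hg, mul_pow, ENNReal.ofReal_pow (by positivity), sq (∑ v, f v x), Finset.sum_mul_sum]
    simp_rw [this]
    have hsum : ∫⁻ x, ∑ v, ∑ w, f v x * f w x ∂P = ∑ v, ∑ w, ∫⁻ x, f v x * f w x ∂P := by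
      rw [lintegral_finsetSum _ fun v _ => by fun_prop]
      exact Finset.sum_congr rfl fun v _ => lintegral_finsetSum _ fun w _ => (hf v).mul (hf w)
    rw [lintegral_const_mul _ (by fun_prop), hsum]
    calc _ ≤ ENNReal.ofReal (N⁻¹ ^ 2) * ENNReal.ofReal (M * N ^ 2) := by gcongr
      _ = ENNReal.ofReal M := by
          rw [← ENNReal.ofReal_mul (by positivity)]; congr 1; field_simp
  have hgA : ∫⁻ x in A, g x ∂P ≤ ENNReal.ofReal (1 / 2) := by
    calc ∫⁻ x in A, g x ∂P
        ≤ ∫⁻ x in A, (ENNReal.ofReal (1 / (4 * M)) * g x ^ 2 + ENNReal.ofReal M) ∂P :=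
          lintegral_mono fun x => le_sq_div_add hM0 _
      _ = ENNReal.ofReal (1 / (4 * M)) * ∫⁻ x in A, g x ^ 2 ∂P + ENNReal.ofReal M * P A := by
          rw [lintegral_add_right _ measurable_const, lintegral_const_mul _ (by fun_prop)]
          simp
      _ ≤ ENNReal.ofReal (1 / (4 * M)) * ENNReal.ofReal M
            + ENNReal.ofReal M * ENNReal.ofReal (1 / (4 * M)) := by
          gcongr
          exact (setLIntegral_le_lintegral A _).trans hg2
      _ = ENNReal.ofReal (1 / 2) := by
          rw [← ENNReal.ofReal_mul (by positivity), ← ENNReal.ofReal_mul (by positivity),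
            ← ENNReal.ofReal_add (by positivity) (by positivity)]
          congr 1; field_simp; norm_num
  have := lintegral_add_compl g hA (μ := P)
  rw [hg1] at this
  have h1 : (1 : ℝ≥0∞) ≤ ENNReal.ofReal (1 / 2) + ENNReal.ofReal (1 / (4 * M)) := by
    rw [← this]; gcongr
  rw [← ENNReal.ofReal_add (by positivity) (by positivity), ← ENNReal.ofReal_one,
    ENNReal.ofReal_le_ofReal_iff (by positivity)] at h1
  have : 1 / (4 * M) ≤ 1 / 4 := by gcongr; linarith
  linarith

/-- Lower bound for the minimax risk by Le Cam's method: the sample is the image under `L` of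
i.i.d. latent variables, with law `P` under the null and `P.withDensity (f v)` under the
alternatives. It suffices to bound the second moment of the mixture of the latent likelihood
ratios. -/
lemma minimaxRisk_ge {n p : ℕ} {q R : ℝ} {Ω V : Type*} [MeasurableSpace Ω] [Fintype V]
    [Nonempty V] (P : Measure Ω) [IsProbabilityMeasure P] {f : V → Ω → ℝ≥0∞}
    (hf : ∀ v, Measurable (f v)) (hf1 : ∀ v, IsProbabilityMeasure (P.withDensity (f v)))
    {L : Ω → EuclideanSpace ℝ (Fin p)} (hL : Measurable L)
    {S₀ : Matrix (Fin p) (Fin p) ℝ} {S : V → Matrix (Fin p) (Fin p) ℝ}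
    (hS₀ : S₀ ∈ sparseClass p q R) (hS : ∀ v, S v ∈ sparseClass p q R)
    (hL₀ : P.map L = multivariateGaussian 0 S₀)
    (hLv : ∀ v, (P.withDensity (f v)).map L = multivariateGaussian 0 (S v))
    {Δ : ℝ} (hΔ : 0 ≤ Δ) (hQ : ∀ v, offDiagQuad (S v) = offDiagQuad S₀ + Δ)
    {c : V → V → ℝ} (hc0 : ∀ v w, 0 ≤ c v w)
    (hc : ∀ v w, ∫⁻ x, f v x * f w x ∂P = ENNReal.ofReal (c v w))
    {M : ℝ} (hM : 1 ≤ M) (hcM : ∑ v, ∑ w, c v w ^ n ≤ M * (Fintype.card V : ℝ) ^ 2) :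
    ENNReal.ofReal (Δ ^ 2 / (16 * M)) ≤ minimaxRisk n p q R := by
  have hM0 : 0 < M := by linarith
  refine le_iInf fun ⟨Qhat, hQm⟩ => ?_
  set PP := Measure.pi fun _ : Fin n => P
  set F : V → (Fin n → Ω) → ℝ≥0∞ := fun v ω => ∏ i, f v (ω i) with hF
  set LL : (Fin n → Ω) → Fin n → EuclideanSpace ℝ (Fin p) := fun ω i => L (ω i)
  have hLL : Measurable LL := by fun_prop
  have hFm : ∀ v, Measurable (F v) := fun v => by fun_prop
  have law₀ : sampleLaw n S₀ = PP.map LL := by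
    have : IsProbabilityMeasure (P.map L) := Measure.isProbabilityMeasure_map hL.aemeasurable
    rw [sampleLaw, ← hL₀, Measure.pi_map_pi fun _ => hL.aemeasurable]
  have law : ∀ v, sampleLaw n (S v) = (PP.withDensity (F v)).map LL := fun v => by
    have := hf1 v
    have : IsProbabilityMeasure ((P.withDensity (f v)).map L) :=
      Measure.isProbabilityMeasure_map hL.aemeasurable
    rw [sampleLaw, ← hLv, ← pi_withDensity P (hf v), Measure.pi_map_pi fun _ => hL.aemeasurable]
  have hF1 : ∀ v, ∫⁻ x, F v x ∂PP = 1 := fun v => by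
    rw [lintegral_pi_prod P fun _ => hf v]
    have := (hf1 v).measure_univ
    rw [withDensity_apply _ .univ, setLIntegral_univ] at this
    simp [this]
  have hF2 : ∑ v, ∑ w, ∫⁻ x, F v x * F w x ∂PP ≤
      ENNReal.ofReal (M * (Fintype.card V : ℝ) ^ 2) := by
    have : ∀ v w, ∫⁻ x, F v x * F w x ∂PP = ENNReal.ofReal (c v w ^ n) := fun v w => by
      simp_rw [hF, ← Finset.prod_mul_distrib]
      rw [lintegral_pi_prod P (h := fun _ x => f v x * f w x) fun _ => (hf v).mul (hf w)]
      simp [hc, ENNReal.ofReal_pow (hc0 v w)]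
    simp_rw [this]
    simp_rw [← ENNReal.ofReal_sum_of_nonneg fun w _ => pow_nonneg (hc0 _ w) n]
    rw [← ENNReal.ofReal_sum_of_nonneg fun v _ =>
      Finset.sum_nonneg fun w _ => pow_nonneg (hc0 v w) n]
    exact ENNReal.ofReal_le_ofReal hcM
  set A : Set (Fin n → Ω) := {ω | offDiagQuad S₀ + Δ / 2 ≤ Qhat (LL ω)} with hA
  have hAm : MeasurableSet A := measurableSet_le measurable_const (hQm.comp hLL)
  have hrate : ENNReal.ofReal (Δ ^ 2 / (16 * M)) =
      ENNReal.ofReal ((Δ / 2) ^ 2) * ENNReal.ofReal (1 / (4 * M)) := by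
    rw [← ENNReal.ofReal_mul (by positivity)]; congr 1; field_simp; ring
  have hlm : ∀ T : Matrix (Fin p) (Fin p) ℝ, Measurable fun X =>
      ENNReal.ofReal ((Qhat X - offDiagQuad T) ^ 2) := fun T => by fun_prop
  rcases testing_lower_bound PP hFm hF1 hM hF2 hAm with h | ⟨v, h⟩
  · refine le_trans ?_ (le_iSup₂ S₀ hS₀)
    rw [law₀, lintegral_map (hlm _) hLL, hrate]
    calc _ ≤ ENNReal.ofReal ((Δ / 2) ^ 2) * PP A := by gcongr
      _ = ∫⁻ _ in A, ENNReal.ofReal ((Δ / 2) ^ 2) ∂PP := by simp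
      _ ≤ ∫⁻ ω in A, ENNReal.ofReal ((Qhat (LL ω) - offDiagQuad S₀) ^ 2) ∂PP := by
          refine setLIntegral_mono ((hlm _).comp hLL) fun ω hω => ?_
          refine ENNReal.ofReal_le_ofReal ?_
          have : offDiagQuad S₀ + Δ / 2 ≤ Qhat (LL ω) := hω
          exact pow_le_pow_left₀ (by positivity) (by linarith) 2
      _ ≤ _ := setLIntegral_le_lintegral _ _
  · refine le_trans ?_ (le_iSup₂ (S v) (hS v))
    rw [law, lintegral_map (hlm _) hLL, hrate]
    refine le_trans ?_
      (lintegral_withDensity_eq_lintegral_mul PP (hFm v) ((hlm (S v)).comp hLL)).ge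
    calc _ ≤ ENNReal.ofReal ((Δ / 2) ^ 2) * ∫⁻ ω in Aᶜ, F v ω ∂PP := by gcongr
      _ = ∫⁻ ω in Aᶜ, ENNReal.ofReal ((Δ / 2) ^ 2) * F v ω ∂PP := by
          rw [lintegral_const_mul _ (hFm v)]
      _ ≤ ∫⁻ ω in Aᶜ, F v ω * ENNReal.ofReal ((Qhat (LL ω) - offDiagQuad (S v)) ^ 2) ∂PP := by
          refine setLIntegral_mono ((hFm v).mul ((hlm _).comp hLL)) fun ω hω => ?_
          rw [mul_comm]
          refine mul_le_mul' le_rfl (ENNReal.ofReal_le_ofReal ?_)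
          have : Qhat (LL ω) < offDiagQuad S₀ + Δ / 2 := not_le.1 hω
          rw [hQ]
          nlinarith
      _ ≤ _ := setLIntegral_le_lintegral _ _

/-! ### Gaussian latent variables and their tilts -/

section Gaussian

open Matrix

variable {ι m : Type*} [Fintype ι]

/-- The standard Gaussian law of the latent variables `(y, x)`, `y ∈ ℝ^ι` and `x ∈ ℝ`. -/
noncomputable def latentLaw (ι : Type*) [Fintype ι] : Measure ((ι → ℝ) × ℝ) :=
  (Measure.pi fun _ : ι => gaussianReal 0 1).prod (gaussianReal 0 1)

instance : IsProbabilityMeasure (latentLaw ι) := by unfold latentLaw; infer_instance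

/-- The likelihood ratio, with respect to `latentLaw ι`, of the Gaussian law under which `y` and
`x` remain standard Gaussian while the covariance of `x` and `y` is `v`: given `y`, the variable
`x` has mean `v ⬝ᵥ y` and variance `1 - v ⬝ᵥ v`. -/
noncomputable def tilt (v : ι → ℝ) (z : (ι → ℝ) × ℝ) : ℝ≥0∞ :=
  gaussianPDF (v ⬝ᵥ z.1) (1 - v ⬝ᵥ v).toNNReal z.2 / gaussianPDF 0 1 z.2

lemma measurable_dotProduct_left (v : ι → ℝ) : Measurable fun y : ι → ℝ => v ⬝ᵥ y := by
  unfold dotProduct; fun_prop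

lemma measurable_gaussianPDF_comp {Ω : Type*} [MeasurableSpace Ω] {f g : Ω → ℝ}
    (hf : Measurable f) (hg : Measurable g) (s : NNReal) :
    Measurable fun ω => gaussianPDF (f ω) s (g ω) :=
  measurable_uncurry_gaussianPDF.comp (hf.prodMk (measurable_const.prodMk hg))

lemma measurable_tilt (v : ι → ℝ) : Measurable (tilt v) :=
  (measurable_gaussianPDF_comp ((measurable_dotProduct_left v).comp measurable_fst)
    measurable_snd _).div ((measurable_gaussianPDF 0 1).comp measurable_snd)

lemma gaussianPDF_mul_div_cancel (x : ℝ) (c : ℝ≥0∞) :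
    gaussianPDF 0 1 x * (c / gaussianPDF 0 1 x) = c :=
  ENNReal.mul_div_cancel (gaussianPDF_pos 0 one_ne_zero x).ne' gaussianPDF_ne_top

lemma lintegral_gaussianReal {v : NNReal} (hv : v ≠ 0) (m : ℝ) {h : ℝ → ℝ≥0∞}
    (hh : Measurable h) :
    ∫⁻ x, h x ∂(gaussianReal m v) = ∫⁻ x, gaussianPDF m v x * h x := by
  rw [gaussianReal_of_var_ne_zero m hv,
    lintegral_withDensity_eq_lintegral_mul _ (measurable_gaussianPDF m v) hh]
  rfl

/-- Under the tilt by `v`, the variable `x` is the regression `v ⬝ᵥ y` on `y` plus independent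
Gaussian noise of variance `1 - v ⬝ᵥ v`. -/
lemma withDensity_tilt {v : ι → ℝ} (hv : v ⬝ᵥ v < 1) :
    (latentLaw ι).withDensity (tilt v) =
      (latentLaw ι).map fun z => (z.1, v ⬝ᵥ z.1 + √(1 - v ⬝ᵥ v) * z.2) := by
  have hm := measurable_dotProduct_left v
  have hT : Measurable fun z : (ι → ℝ) × ℝ => (z.1, v ⬝ᵥ z.1 + √(1 - v ⬝ᵥ v) * z.2) := by
    fun_prop
  have hs : (1 - v ⬝ᵥ v).toNNReal ≠ 0 := by simpa using hv
  refine Measure.ext_of_lintegral _ fun h hh => ?_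
  rw [lintegral_withDensity_eq_lintegral_mul _ (measurable_tilt v) hh, lintegral_map hh hT,
    latentLaw, lintegral_prod _ ((measurable_tilt v).mul hh).aemeasurable,
    lintegral_prod (fun z : (ι → ℝ) × ℝ => h (z.1, v ⬝ᵥ z.1 + √(1 - v ⬝ᵥ v) * z.2))
      (hh.comp hT).aemeasurable]
  refine lintegral_congr fun y => ?_
  have hy : Measurable fun x => h (y, x) := hh.comp measurable_prodMk_left
  calc ∫⁻ x, (tilt v * h) (y, x) ∂(gaussianReal 0 1)
      = ∫⁻ x, gaussianPDF (v ⬝ᵥ y) (1 - v ⬝ᵥ v).toNNReal x * h (y, x) := by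
        rw [lintegral_gaussianReal one_ne_zero 0
          (h := fun x => (tilt v * h) (y, x))
          (((measurable_tilt v).mul hh).comp measurable_prodMk_left)]
        refine lintegral_congr fun x => ?_
        simp only [Pi.mul_apply, tilt]
        rw [← mul_assoc, gaussianPDF_mul_div_cancel]
    _ = ∫⁻ x, h (y, x) ∂(gaussianReal (v ⬝ᵥ y) (1 - v ⬝ᵥ v).toNNReal) :=
        (lintegral_gaussianReal hs _ hy).symm
    _ = ∫⁻ x, h (y, v ⬝ᵥ y + √(1 - v ⬝ᵥ v) * x) ∂(gaussianReal 0 1) := by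
        have : gaussianReal (v ⬝ᵥ y) (1 - v ⬝ᵥ v).toNNReal =
            (gaussianReal 0 1).map fun x => v ⬝ᵥ y + √(1 - v ⬝ᵥ v) * x := by
          have h1 := gaussianReal_map_const_mul (μ := 0) (v := 1) (√(1 - v ⬝ᵥ v))
          have h2 := gaussianReal_map_const_add (μ := 0) (v := (1 - v ⬝ᵥ v).toNNReal) (v ⬝ᵥ y)
          rw [zero_add] at h2
          rw [← h2]
          have h3 : (gaussianReal 0 1).map (fun x => √(1 - v ⬝ᵥ v) * x) =
              gaussianReal 0 (1 - v ⬝ᵥ v).toNNReal := by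
            rw [h1]
            congr 1
            · simp
            · ext; simp [Real.sq_sqrt, hv.le, Real.toNNReal_of_nonneg]
          rw [← h3, Measure.map_map (by fun_prop) (by fun_prop)]
          rfl
        rw [this, lintegral_map hy (by fun_prop)]

lemma isProbabilityMeasure_withDensity_tilt {v : ι → ℝ} (hv : v ⬝ᵥ v < 1) :
    IsProbabilityMeasure ((latentLaw ι).withDensity (tilt v)) := by
  rw [withDensity_tilt hv]
  have hm := measurable_dotProduct_left v
  exact Measure.isProbabilityMeasure_map (by fun_prop)

lemma integral_cexp_latentLaw (a : ι → ℝ) (b : ℝ) :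
    ∫ z, Complex.exp (((a ⬝ᵥ z.1 + b * z.2 : ℝ) : ℂ) * Complex.I) ∂(latentLaw ι) =
      Complex.exp (-((a ⬝ᵥ a + b ^ 2 : ℝ) : ℂ) / 2) := by
  have h1 (t : ℝ) : ∫ x, Complex.exp (((t * x : ℝ) : ℂ) * Complex.I) ∂(gaussianReal 0 1) =
      Complex.exp (-((t ^ 2 : ℝ) : ℂ) / 2) := by
    have := charFun_gaussianReal (μ := 0) (v := 1) t
    rw [charFun_apply_real] at this
    simp only [Complex.ofReal_mul, this]
    congr 1
    push_cast; ring
  have h2 : ∀ z : (ι → ℝ) × ℝ, Complex.exp (((a ⬝ᵥ z.1 + b * z.2 : ℝ) : ℂ) * Complex.I) =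
      (∏ j, Complex.exp (((a j * z.1 j : ℝ) : ℂ) * Complex.I)) *
        Complex.exp (((b * z.2 : ℝ) : ℂ) * Complex.I) := fun z => by
    rw [← Complex.exp_sum, ← Complex.exp_add, ← Finset.sum_mul, ← add_mul]
    congr 2
    simp [dotProduct]
  simp_rw [h2]
  rw [latentLaw, integral_prod_mul
    (fun y : ι → ℝ => ∏ j, Complex.exp (((a j * y j : ℝ) : ℂ) * Complex.I))
    (fun x : ℝ => Complex.exp (((b * x : ℝ) : ℂ) * Complex.I)),
    integral_fintype_prod_eq_prod
      (f := fun j (t : ℝ) => Complex.exp (((a j * t : ℝ) : ℂ) * Complex.I))]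
  simp_rw [h1]
  rw [← Complex.exp_sum, ← Complex.exp_add]
  congr 1
  simp only [dotProduct, Complex.ofReal_add, Complex.ofReal_sum, ← Finset.sum_div,
    Finset.sum_neg_distrib, sq]
  ring

lemma measurable_toLp_mulVec_add (a : Matrix m ι ℝ) (b : m → ℝ) :
    Measurable fun z : (ι → ℝ) × ℝ =>
      (WithLp.toLp 2 (a *ᵥ z.1 + z.2 • b) : EuclideanSpace ℝ m) := by
  refine (WithLp.measurable_toLp 2 _).comp (measurable_pi_lambda _ fun i => ?_)
  have := measurable_dotProduct_left (a i)
  simp only [Pi.add_apply, Pi.smul_apply, smul_eq_mul, mulVec]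
  fun_prop

/-- The covariance matrix of the vector with coordinates `a i ⬝ᵥ y + b i * x`, when `y` and `x` are
standard Gaussian and the covariance of `x` and `y` is `v`. -/
def latentCov (a : m → ι → ℝ) (b : m → ℝ) (v : ι → ℝ) : Matrix m m ℝ :=
  of fun i j => a i ⬝ᵥ a j + b j * (a i ⬝ᵥ v) + b i * (a j ⬝ᵥ v) + b i * b j

lemma latentCov_eq {v : ι → ℝ} (hv : v ⬝ᵥ v < 1) (a : m → ι → ℝ) (b : m → ℝ) :
    latentCov a b v = (of a + vecMulVec b v) * (of a + vecMulVec b v)ᵀ +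
        vecMulVec (√(1 - v ⬝ᵥ v) • b) (√(1 - v ⬝ᵥ v) • b) := by
  have hvr : √(1 - v ⬝ᵥ v) * √(1 - v ⬝ᵥ v) = 1 - v ⬝ᵥ v := Real.mul_self_sqrt (by linarith)
  ext i j
  have h1 : ((of a + vecMulVec b v) * (of a + vecMulVec b v)ᵀ) i j =
      (a i + b i • v) ⬝ᵥ (a j + b j • v) := rfl
  have h2 : vecMulVec (√(1 - v ⬝ᵥ v) • b) (√(1 - v ⬝ᵥ v) • b) i j =
      √(1 - v ⬝ᵥ v) * √(1 - v ⬝ᵥ v) * (b i * b j) := by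
    simp only [vecMulVec_apply, Pi.smul_apply, smul_eq_mul]; ring
  rw [Matrix.add_apply, h1, h2, hvr]
  simp only [latentCov, of_apply, add_dotProduct, dotProduct_add, smul_dotProduct,
    dotProduct_smul, smul_eq_mul, dotProduct_comm v (a j)]
  ring

variable [Fintype m]

lemma posSemidef_mul_transpose_add (a : Matrix m ι ℝ) (b : m → ℝ) :
    (a * aᵀ + vecMulVec b b).PosSemidef := by
  have h1 := posSemidef_self_mul_conjTranspose a
  have h2 := posSemidef_vecMulVec_self_star b
  rw [conjTranspose_eq_transpose_of_trivial] at h1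
  rw [star_trivial] at h2
  exact h1.add h2

lemma posSemidef_latentCov {v : ι → ℝ} (hv : v ⬝ᵥ v < 1) (a : m → ι → ℝ) (b : m → ℝ) :
    (latentCov a b v).PosSemidef := by
  rw [latentCov_eq hv]
  exact posSemidef_mul_transpose_add _ _

variable [DecidableEq m]

/-- Linear images of the latent variables are Gaussian, by comparison of characteristic functions. -/
lemma map_latentLaw (a : Matrix m ι ℝ) (b : m → ℝ) :
    (latentLaw ι).map (fun z => WithLp.toLp 2 (a *ᵥ z.1 + z.2 • b)) =
      multivariateGaussian 0 (a * aᵀ + vecMulVec b b) := by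
  have hmeas := measurable_toLp_mulVec_add a b
  have : IsProbabilityMeasure ((latentLaw ι).map fun z =>
      (WithLp.toLp 2 (a *ᵥ z.1 + z.2 • b) : EuclideanSpace ℝ m)) :=
    Measure.isProbabilityMeasure_map hmeas.aemeasurable
  refine Measure.ext_of_charFun (funext fun t => ?_)
  rw [charFun_multivariateGaussian (posSemidef_mul_transpose_add a b), charFun_apply,
    integral_map hmeas.aemeasurable (by fun_prop)]
  have h1 : ∀ z : (ι → ℝ) × ℝ, inner ℝ (WithLp.toLp 2 (a *ᵥ z.1 + z.2 • b)) t =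
      (WithLp.ofLp t ᵥ* a) ⬝ᵥ z.1 + (WithLp.ofLp t ⬝ᵥ b) * z.2 := fun z => by
    rw [EuclideanSpace.inner_eq_star_dotProduct, star_trivial, dotProduct_add, dotProduct_mulVec,
      dotProduct_smul, smul_eq_mul, mul_comm z.2]
  simp_rw [h1, integral_cexp_latentLaw]
  congr 1
  have h2 : WithLp.ofLp t ⬝ᵥ (a * aᵀ + vecMulVec b b) *ᵥ WithLp.ofLp t =
      (WithLp.ofLp t ᵥ* a) ⬝ᵥ (WithLp.ofLp t ᵥ* a) + (WithLp.ofLp t ⬝ᵥ b) ^ 2 := by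
    rw [add_mulVec, dotProduct_add, ← mulVec_mulVec, dotProduct_mulVec, mulVec_transpose,
      vecMulVec_mulVec, dotProduct_smul, dotProduct_comm b, sq]
    simp
  rw [h2]
  simp
  ring

lemma map_withDensity_tilt_eq_add {v : ι → ℝ} (hv : v ⬝ᵥ v < 1) (a : Matrix m ι ℝ) (b : m → ℝ) :
    ((latentLaw ι).withDensity (tilt v)).map (fun z => WithLp.toLp 2 (a *ᵥ z.1 + z.2 • b)) =
      multivariateGaussian 0 ((a + vecMulVec b v) * (a + vecMulVec b v)ᵀ +
        vecMulVec (√(1 - v ⬝ᵥ v) • b) (√(1 - v ⬝ᵥ v) • b)) := by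
  have hm := measurable_dotProduct_left v
  have hmeas := measurable_toLp_mulVec_add a b
  rw [withDensity_tilt hv, Measure.map_map hmeas (by fun_prop), ← map_latentLaw]
  congr 1
  funext z
  simp only [Function.comp_apply, add_mulVec, vecMulVec_mulVec]
  congr 1
  ext i
  simp
  ring

lemma map_withDensity_tilt {v : ι → ℝ} (hv : v ⬝ᵥ v < 1) (a : m → ι → ℝ) (b : m → ℝ) :
    ((latentLaw ι).withDensity (tilt v)).map (fun z => WithLp.toLp 2 (of a *ᵥ z.1 + z.2 • b)) =
      multivariateGaussian 0 (latentCov a b v) := by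
  rw [latentCov_eq hv, map_withDensity_tilt_eq_add hv]

lemma map_latentLaw_eq (a : m → ι → ℝ) (b : m → ℝ) :
    (latentLaw ι).map (fun z => WithLp.toLp 2 (of a *ᵥ z.1 + z.2 • b)) =
      multivariateGaussian 0 (latentCov a b 0) := by
  have : vecMulVec b (0 : ι → ℝ) = 0 := by ext; simp [vecMulVec_apply]
  rw [latentCov_eq (by simp), map_latentLaw, this]
  simp

lemma gaussianPDF_affine_mean {ρ : ℝ} (hρ : ρ < 1) (t x : ℝ) {s : ℝ} (hs : 0 < s) :
    gaussianPDF (t + x * ρ) s.toNNReal x = ENNReal.ofReal (1 / (1 - ρ)) *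
      gaussianPDF (t / (1 - ρ)) (s / (1 - ρ) ^ 2).toNNReal x := by
  have h1 : 0 < 1 - ρ := by linarith
  rw [gaussianPDF, gaussianPDF, ← ENNReal.ofReal_mul (by positivity)]
  congr 1
  rw [gaussianPDFReal, gaussianPDFReal, Real.coe_toNNReal _ hs.le,
    Real.coe_toNNReal _ (by positivity), ← mul_assoc]
  congr 1
  · rw [← mul_div_assoc, Real.sqrt_div (by positivity), Real.sqrt_sq h1.le]
    field_simp
  · congr 1
    field_simp
    ring

lemma dotProduct_sq_le (v w : ι → ℝ) : (v ⬝ᵥ w) ^ 2 ≤ (v ⬝ᵥ v) * (w ⬝ᵥ w) := by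
  simpa [dotProduct, sq] using Finset.sum_mul_sq_le_sq_mul_sq Finset.univ v w

/-- The cross moments of the likelihood ratios. Under the tilt by `v`, the pair `(w ⬝ᵥ y, x)` has
the law of `(ρ x + c e, x)` with `x`, `e` independent and standard Gaussian, `ρ = v ⬝ᵥ w` and
`ρ² + c² = w ⬝ᵥ w`. In that representation the density of `x` cancels the denominator of `tilt w`,
and the remaining Lebesgue integral in `x` is that of a Gaussian density, up to the scaling
`1 - ρ`. -/
lemma lintegral_tilt_mul_tilt {v w : ι → ℝ} (hv : v ⬝ᵥ v < 1) (hw : w ⬝ᵥ w < 1) :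
    ∫⁻ z, tilt v z * tilt w z ∂(latentLaw ι) = ENNReal.ofReal (1 / (1 - v ⬝ᵥ w)) := by
  have hcs := dotProduct_sq_le v w
  have hv0 : 0 ≤ v ⬝ᵥ v := Finset.sum_nonneg fun i _ => mul_self_nonneg (v i)
  have hw0 : 0 ≤ w ⬝ᵥ w := Finset.sum_nonneg fun i _ => mul_self_nonneg (w i)
  set ρ := v ⬝ᵥ w with hρdef
  have hρw : ρ ^ 2 ≤ w ⬝ᵥ w := by nlinarith
  have hρ : ρ < 1 := by nlinarith
  have hs : 0 < 1 - w ⬝ᵥ w := by linarith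
  set s := 1 - w ⬝ᵥ w with hsdef
  set c := √(w ⬝ᵥ w - ρ ^ 2) with hcdef
  have hc : c * c = w ⬝ᵥ w - ρ ^ 2 := Real.mul_self_sqrt (by linarith)
  set h : EuclideanSpace ℝ (Fin 2) → ℝ≥0∞ := fun u =>
    gaussianPDF (u 0) s.toNNReal (u 1) / gaussianPDF 0 1 (u 1) with hdef
  have hm : Measurable h :=
    (measurable_gaussianPDF_comp (by fun_prop) (by fun_prop) _).div
      ((measurable_gaussianPDF 0 1).comp (by fun_prop))
  have htilt : ∀ z : (ι → ℝ) × ℝ, tilt w z =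
      h (WithLp.toLp 2 ((of ![w, 0] : Matrix (Fin 2) ι ℝ) *ᵥ z.1 + z.2 • ![0, 1])) := fun z => by
    simp [hdef, tilt, hsdef]
  have hlaw : ((latentLaw ι).withDensity (tilt v)).map (fun z => (WithLp.toLp 2
      ((of ![w, 0] : Matrix (Fin 2) ι ℝ) *ᵥ z.1 + z.2 • ![0, 1]) : EuclideanSpace ℝ (Fin 2))) =
      (latentLaw Unit).map (fun z => WithLp.toLp 2
        ((of ![fun _ => c, 0] : Matrix (Fin 2) Unit ℝ) *ᵥ z.1 + z.2 • ![ρ, 1])) := by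
    rw [map_withDensity_tilt hv, map_latentLaw_eq]
    congr 1
    ext i j
    fin_cases i <;> fin_cases j <;>
      (simp [latentCov, dotProduct_comm w v, ← hρdef]; try (simp [dotProduct, hc]; try ring))
  have hT := measurable_toLp_mulVec_add (of ![w, 0] : Matrix (Fin 2) ι ℝ) ![0, 1]
  have hT' := measurable_toLp_mulVec_add (of ![fun _ => c, 0] : Matrix (Fin 2) Unit ℝ) ![ρ, 1]
  have hval : ∀ (y : Unit → ℝ) (x : ℝ), h (WithLp.toLp 2
      ((of ![fun _ => c, 0] : Matrix (Fin 2) Unit ℝ) *ᵥ y + x • ![ρ, 1])) =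
      gaussianPDF (c * y () + x * ρ) s.toNNReal x / gaussianPDF 0 1 x := fun y x => by
    simp [hdef, dotProduct]
  calc ∫⁻ z, tilt v z * tilt w z ∂(latentLaw ι)
      = ∫⁻ z, tilt w z ∂((latentLaw ι).withDensity (tilt v)) :=
        (lintegral_withDensity_eq_lintegral_mul _ (measurable_tilt v) (measurable_tilt w)).symm
    _ = ∫⁻ u, h u ∂((latentLaw Unit).map (fun z => WithLp.toLp 2
        ((of ![fun _ => c, 0] : Matrix (Fin 2) Unit ℝ) *ᵥ z.1 + z.2 • ![ρ, 1]))) := by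
        rw [← hlaw, lintegral_map hm hT]
        exact lintegral_congr htilt
    _ = ∫⁻ y : Unit → ℝ, ∫⁻ x, gaussianPDF (c * y () + x * ρ) s.toNNReal x
          ∂(volume : Measure ℝ) ∂(Measure.pi fun _ : Unit => gaussianReal 0 1) := by
        rw [lintegral_map hm hT', latentLaw]
        refine (lintegral_prod _ (hm.comp hT').aemeasurable).trans (lintegral_congr fun y => ?_)
        simp only [Function.comp_apply, hval]
        rw [lintegral_gaussianReal one_ne_zero 0
          (h := fun x => gaussianPDF (c * y () + x * ρ) s.toNNReal x / gaussianPDF 0 1 x)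
          ((measurable_gaussianPDF_comp (by fun_prop) (by fun_prop) _).div
            (measurable_gaussianPDF 0 1))]
        exact lintegral_congr fun x => gaussianPDF_mul_div_cancel x _
    _ = ∫⁻ _y, ENNReal.ofReal (1 / (1 - ρ))
          ∂(Measure.pi fun _ : Unit => gaussianReal 0 1) := by
        refine lintegral_congr fun y => ?_
        have h1 : 0 < 1 - ρ := by linarith
        simp_rw [gaussianPDF_affine_mean hρ _ _ hs]
        rw [lintegral_const_mul _ (measurable_gaussianPDF _ _),
          lintegral_gaussianPDF_eq_one _ (by simpa using by positivity), mul_one]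
    _ = ENNReal.ofReal (1 / (1 - ρ)) := by simp

lemma dotProduct_lt_one {v w : ι → ℝ} (hv : v ⬝ᵥ v < 1) (hw : w ⬝ᵥ w < 1) : v ⬝ᵥ w < 1 := by
  have h0 : 0 ≤ (v - w) ⬝ᵥ (v - w) := Finset.sum_nonneg fun i _ => mul_self_nonneg ((v - w) i)
  simp only [sub_dotProduct, dotProduct_sub, dotProduct_comm w v] at h0
  linarith

/-- Le Cam's bound for a null under which the latent variables are standard Gaussian and
alternatives given by tilts, the observations being linear in the latent variables. -/
lemma minimaxRisk_ge_of_tilt {n p : ℕ} {q R : ℝ} {V : Type*} [Fintype V] [Nonempty V]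
    (a : Fin p → ι → ℝ) (b : Fin p → ℝ) {v : V → ι → ℝ} (hv : ∀ f, v f ⬝ᵥ v f < 1)
    (hS₀ : latentCov a b 0 ∈ sparseClass p q R)
    (hS : ∀ f, latentCov a b (v f) ∈ sparseClass p q R) {Δ : ℝ} (hΔ : 0 ≤ Δ)
    (hQ : ∀ f, offDiagQuad (latentCov a b (v f)) = offDiagQuad (latentCov a b 0) + Δ)
    {M : ℝ} (hM : 1 ≤ M)
    (hcM : ∑ f, ∑ g, (1 / (1 - v f ⬝ᵥ v g)) ^ n ≤ M * (Fintype.card V : ℝ) ^ 2) :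
    ENNReal.ofReal (Δ ^ 2 / (16 * M)) ≤ minimaxRisk n p q R :=
  minimaxRisk_ge (latentLaw ι) (f := fun f => tilt (v f)) (fun f => measurable_tilt (v f))
    (fun f => isProbabilityMeasure_withDensity_tilt (hv f)) (measurable_toLp_mulVec_add (of a) b)
    hS₀ hS (map_latentLaw_eq a b) (fun f => map_withDensity_tilt (hv f) a b) hΔ hQ
    (fun f g => by have := dotProduct_lt_one (hv f) (hv g); exact (one_div_pos.2 (by linarith)).le)
    (fun f g => lintegral_tilt_mul_tilt (hv f) (hv g)) hM hcM

end Gaussian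

/-! ### The parametric rate: two blocks with a perturbed cross-correlation -/

section TwoBlocks

open Matrix

variable {p : ℕ}

/-- The correlation matrix with two blocks `{0, …, m-1}` and `{m, …, 2m-1}` of perfectly correlated
variables, with correlation `r` between the blocks; the remaining variables are uncorrelated. -/
def twoBlockCov (p m : ℕ) (r : ℝ) : Matrix (Fin p) (Fin p) ℝ :=
  of fun i j => if i = j then 1 else if i.1 < 2 * m ∧ j.1 < 2 * m then
    (if i.1 < m ↔ j.1 < m then 1 else r) else 0

/-- Loadings of the observations on the latent vector `y`. Index `inl 0` is the part of `y` specific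
to the first block (that of the second block is the latent variable `x`), `inl 1` is the factor
shared by both blocks, and the indices `inr i` are noise for the variables outside the blocks. -/
noncomputable def twoBlockLoading (p m : ℕ) (r : ℝ) (i : Fin p) : Fin 2 ⊕ Fin p → ℝ :=
  if i.1 < m then √r • Pi.single (Sum.inl 1) 1 + √(1 - r) • Pi.single (Sum.inl 0) 1
  else if i.1 < 2 * m then √r • Pi.single (Sum.inl 1) 1
  else Pi.single (Sum.inr i) 1

/-- Loadings of the observations on the latent variable `x`. -/
noncomputable def twoBlockShift (p m : ℕ) (r : ℝ) (i : Fin p) : ℝ :=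
  if m ≤ i.1 ∧ i.1 < 2 * m then √(1 - r) else 0

lemma latentCov_twoBlock {m : ℕ} {r : ℝ} (h0 : 0 ≤ r) (h1 : r ≤ 1) (t : ℝ) :
    latentCov (twoBlockLoading p m r) (twoBlockShift p m r) (t • Pi.single (Sum.inl 0) 1) =
      twoBlockCov p m (r + (1 - r) * t) := by
  have hr : √r * √r = r := Real.mul_self_sqrt h0
  have hr' : √(1 - r) * √(1 - r) = 1 - r := Real.mul_self_sqrt (by linarith)
  have hcase : ∀ i : Fin p, i.1 < m ∨ (m ≤ i.1 ∧ i.1 < 2 * m) ∨ 2 * m ≤ i.1 := by omega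
  ext i j
  by_cases hij : i = j
  · subst hij
    simp only [latentCov, twoBlockCov, of_apply, if_true]
    rcases hcase i with hi | hi | hi
    · simp [twoBlockLoading, twoBlockShift, hi, hi.not_ge, hr, hr']
    · simp [twoBlockLoading, twoBlockShift, hi, hi.1.not_gt, hr, hr']
    · have : ¬ i.1 < m := by omega
      simp [twoBlockLoading, twoBlockShift, hi.not_gt, this]
  · have hji : j ≠ i := Ne.symm hij
    simp only [latentCov, twoBlockCov, of_apply, if_neg hij]
    rcases hcase i with hi | hi | hi <;> rcases hcase j with hj | hj | hj
    · have : i.1 < 2 * m := by omega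
      have : j.1 < 2 * m := by omega
      simp [twoBlockLoading, twoBlockShift, hi.not_ge, hj.not_ge, *]
    · have : i.1 < 2 * m := by omega
      have : ¬ j.1 < m := by omega
      simp [twoBlockLoading, twoBlockShift, hi.not_ge, *]
      linear_combination t * hr'
    · have : ¬ j.1 < 2 * m := by omega
      have : ¬ j.1 < m := by omega
      simp [twoBlockLoading, twoBlockShift, hi.not_ge, *]
    · have : j.1 < 2 * m := by omega
      have : ¬ i.1 < m := by omega
      simp [twoBlockLoading, twoBlockShift, hj.not_ge, *]
      linear_combination t * hr'
    · have : ¬ j.1 < m := by omega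
      have : ¬ i.1 < m := by omega
      simp [twoBlockLoading, twoBlockShift, *]
    · have : ¬ j.1 < 2 * m := by omega
      have : ¬ j.1 < m := by omega
      have : ¬ i.1 < m := by omega
      simp [twoBlockLoading, twoBlockShift, *]
    · have : ¬ i.1 < 2 * m := by omega
      have : ¬ i.1 < m := by omega
      simp [twoBlockLoading, twoBlockShift, hj.not_ge, *]
    · have : ¬ i.1 < 2 * m := by omega
      have : ¬ i.1 < m := by omega
      have : ¬ j.1 < m := by omega
      simp [twoBlockLoading, twoBlockShift, *]
    · have : ¬ i.1 < 2 * m := by omega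
      have : ¬ i.1 < m := by omega
      have : ¬ j.1 < 2 * m := by omega
      have : ¬ j.1 < m := by omega
      simp [twoBlockLoading, twoBlockShift, *]

/-- There are `2 m (2 m - 1)` off-diagonal entries inside the blocks. They are `1` or `r`, and for
`m = 1` all of them are `r`, so that only `r ^ q` has to be bounded by `E`. -/
lemma offDiagSparsity_twoBlockCov_le {m : ℕ} (hmp : 2 * m ≤ p) {q r E : ℝ} (hr : 0 ≤ r)
    (hE0 : 0 ≤ E) (hrE : r ^ q ≤ E) (hE : m = 1 ∨ 1 ≤ E) :
    offDiagSparsity q (twoBlockCov p m r) ≤ (2 * m * (2 * m - 1)) * E := by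
  set T : Finset (Fin p) := Finset.univ.filter fun i => i.1 < 2 * m with hT
  have hTcard : T.card = 2 * m := by rw [hT, Fin.card_filter_val_lt]; omega
  have hoff : ((T.offDiag.card : ℕ) : ℝ) = 2 * m * (2 * m - 1) := by
    rw [Finset.offDiag_card, hTcard, Nat.cast_sub (Nat.le_mul_self _)]
    push_cast; ring
  have hsub : T.offDiag ⊆ (Finset.univ : Finset (Fin p)).offDiag :=
    Finset.offDiag_mono (Finset.subset_univ _)
  rw [offDiagSparsity, ← Finset.sum_subset hsub, ← hoff, ← nsmul_eq_mul]
  · refine Finset.sum_le_card_nsmul _ _ _ fun x hx => ?_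
    simp only [Finset.mem_offDiag, hT, Finset.mem_filter, Finset.mem_univ, true_and] at hx
    obtain ⟨h1, h2, h3⟩ := hx
    simp only [twoBlockCov, of_apply, if_neg h3, h1, h2, and_self, if_true]
    by_cases hb : x.1.1 < m ↔ x.2.1 < m
    · have hE1 : 1 ≤ E := hE.resolve_left fun hm => by
        subst hm
        exact h3 (Fin.ext (by omega))
      simpa [hb] using hE1
    · simp only [hb, if_false]
      split_ifs
      · exact hE0
      · rwa [abs_of_nonneg hr]
  · intro x hx hxT
    simp only [Finset.mem_offDiag, hT, Finset.mem_filter, Finset.mem_univ, true_and] at hx hxT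
    have : ¬ (x.1.1 < 2 * m ∧ x.2.1 < 2 * m) := fun h => hxT ⟨h.1, h.2, hx⟩
    simp [twoBlockCov, hx, this]

/-- Only the cross-block entries depend on `r`; `N` is the number of ordered cross-block pairs. -/
lemma exists_offDiagQuad_twoBlockCov {m : ℕ} (hmp : 2 * m ≤ p) (r : ℝ) :
    ∃ N : ℝ, (m : ℝ) ^ 2 ≤ N ∧ ∀ s, offDiagQuad (twoBlockCov p m s) =
      offDiagQuad (twoBlockCov p m r) + N * (s ^ 2 - r ^ 2) := by
  set C := (Finset.univ : Finset (Fin p)).offDiag.filter fun x =>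
    (x.1.1 < 2 * m ∧ x.2.1 < 2 * m) ∧ ¬ (x.1.1 < m ↔ x.2.1 < m) with hC
  refine ⟨C.card, ?_, fun s => ?_⟩
  · set A : Finset (Fin p) := Finset.univ.filter fun i => i.1 < m with hA
    set B : Finset (Fin p) := (Finset.univ.filter fun i => i.1 < 2 * m) \ A with hB
    have hAc : A.card = m := by rw [hA, Fin.card_filter_val_lt]; omega
    have hBc : B.card = m := by
      rw [hB, Finset.card_sdiff_of_subset, hAc, Fin.card_filter_val_lt]
      · omega
      · intro i; simp only [hA, Finset.mem_filter, Finset.mem_univ, true_and]; omega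
    have hsub : A ×ˢ B ⊆ C := by
      intro x
      simp only [hA, hB, hC, Finset.mem_product, Finset.mem_filter, Finset.mem_univ, true_and,
        Finset.mem_sdiff, Finset.mem_offDiag, ne_eq, Fin.ext_iff]
      omega
    have := Finset.card_le_card hsub
    rw [Finset.card_product, hAc, hBc] at this
    rw [sq]
    exact_mod_cast this
  · rw [← sub_eq_iff_eq_add', offDiagQuad, offDiagQuad, ← Finset.sum_sub_distrib, ← nsmul_eq_mul,
      ← Finset.sum_const, hC, Finset.sum_filter]
    refine Finset.sum_congr rfl fun x hx => ?_
    have hx' : x.1 ≠ x.2 := by simpa using hx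
    simp only [twoBlockCov, of_apply, if_neg hx']
    by_cases h1 : x.1.1 < 2 * m ∧ x.2.1 < 2 * m <;> by_cases h2 : (x.1.1 < m ↔ x.2.1 < m) <;>
      simp [h1, h2]

/-- Le Cam's bound for the cross-correlations `r` and `r + (1 - r) t`, the latter arising from a
covariance `t` between the specific parts of the two blocks. -/
lemma minimaxRisk_ge_of_twoBlock {n m : ℕ} (hmp : 2 * m ≤ p) {q R r t : ℝ} (hq : 0 ≤ q)
    (hr0 : 0 < r) (hr1 : r ≤ 1 / 4) (ht0 : 0 ≤ t) (htr : t ≤ r) (hnt : n * t ^ 2 ≤ 1 / 4)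
    (hR : (m = 1 ∧ 2 * (2 * r) ^ q ≤ R) ∨ 4 * (m : ℝ) ^ 2 ≤ R) :
    ENNReal.ofReal ((m : ℝ) ^ 4 * r ^ 2 * t ^ 2 * (3 / 64)) ≤ minimaxRisk n p q R := by
  have hs : r + (1 - r) * t ≤ 2 * r := by nlinarith
  have hmem : ∀ s, 0 ≤ s → s ≤ 2 * r → offDiagSparsity q (twoBlockCov p m s) ≤ R := by
    intro s hs0 hs1
    rcases hR with ⟨rfl, hR⟩ | hR
    · have h := offDiagSparsity_twoBlockCov_le hmp (q := q) hs0 (E := s ^ q) (by positivity) le_rfl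
        (Or.inl rfl)
      have : s ^ q ≤ (2 * r) ^ q := Real.rpow_le_rpow hs0 hs1 hq
      push_cast at h
      linarith
    · have h := offDiagSparsity_twoBlockCov_le hmp (q := q) hs0 (E := 1) zero_le_one
        (Real.rpow_le_one hs0 (by linarith) hq) (Or.inr le_rfl)
      have : (0 : ℝ) ≤ m := by positivity
      nlinarith
  set v : Fin 2 ⊕ Fin p → ℝ := t • Pi.single (Sum.inl 0) 1 with hv
  have hvv : v ⬝ᵥ v = t ^ 2 := by simp [hv, sq]
  have hvv1 : v ⬝ᵥ v < 1 := by rw [hvv]; nlinarith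
  have hcov := latentCov_twoBlock (p := p) (m := m) hr0.le (by linarith : r ≤ 1) t
  have hcov0 := latentCov_twoBlock (p := p) (m := m) hr0.le (by linarith : r ≤ 1) 0
  rw [zero_smul, mul_zero, add_zero] at hcov0
  rw [← hv] at hcov
  have hdiag : ∀ s i, twoBlockCov p m s i i = 1 := fun s i => by simp [twoBlockCov]
  obtain ⟨N, hmN, hN⟩ := exists_offDiagQuad_twoBlockCov hmp r
  set s := r + (1 - r) * t with hsdef
  have hsr : r * t ≤ s ^ 2 - r ^ 2 := by
    have : s ^ 2 - r ^ 2 = (1 - r) * t * (2 * r + (1 - r) * t) := by rw [hsdef]; ring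
    have h2 : 0 ≤ (1 - r) * t := mul_nonneg (by linarith) ht0
    have h3 : 0 ≤ r * t := by positivity
    nlinarith
  have hrt : 0 ≤ r * t := by positivity
  have hmm : (0 : ℝ) ≤ (m : ℝ) ^ 2 := by positivity
  have hΔ : (m : ℝ) ^ 2 * (r * t) ≤ N * (s ^ 2 - r ^ 2) :=
    mul_le_mul hmN hsr hrt (hmm.trans hmN)
  have key := minimaxRisk_ge_of_tilt (n := n) (q := q) (R := R) (V := Unit)
    (twoBlockLoading p m r) (twoBlockShift p m r) (v := fun _ => v) (fun _ => hvv1)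
    ⟨posSemidef_latentCov (by simp) _ _, by rw [hcov0]; exact hmem r hr0.le (by linarith),
      by rw [hcov0]; exact hdiag r⟩
    (fun _ => ⟨posSemidef_latentCov hvv1 _ _, by
      rw [hcov]; exact hmem s (by rw [hsdef]; nlinarith) hs, by rw [hcov]; exact hdiag s⟩)
    (Δ := N * (s ^ 2 - r ^ 2)) (le_trans (by positivity) hΔ)
    (fun _ => by rw [hcov, hcov0]; exact hN s)
    (M := 4 / 3) (by norm_num) (by
      -- Bernoulli's inequality bounds the second moment `(1 - t²)⁻ⁿ` by `4 / 3`.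
      have hb : 1 + (n : ℝ) * -t ^ 2 ≤ (1 + -t ^ 2) ^ n :=
        one_add_mul_le_pow (by nlinarith) n
      have hb' : 3 / 4 ≤ (1 - t ^ 2) ^ n := by
        rw [sub_eq_add_neg]; linarith
      simp only [hvv, Finset.univ_unique, Finset.sum_const, Finset.card_singleton, one_smul,
        Fintype.card_unit, one_div, inv_pow]
      calc ((1 - t ^ 2) ^ n)⁻¹ ≤ (3 / 4)⁻¹ := by gcongr
        _ = _ := by norm_num)
  refine le_trans (ENNReal.ofReal_le_ofReal ?_) key
  have := pow_le_pow_left₀ (by positivity) hΔ 2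
  have h4 : (m : ℝ) ^ 4 * r ^ 2 * t ^ 2 * (3 / 64) =
    ((m : ℝ) ^ 2 * (r * t)) ^ 2 / (16 * (4 / 3)) := by ring
  rw [h4]
  gcongr

end TwoBlocks

/-- The minimax risk is at least of the parametric order `R² / n`. -/
lemma exists_parametric_lower_bound {q R₀ : ℝ} (hq : 0 ≤ q) (hR₀ : 0 < R₀) :
    ∃ C : ℝ, 0 < C ∧ ∀ R : ℝ, R₀ ≤ R → (q = 0 → 2 ≤ R) → ∀ n p : ℕ, 1 ≤ n →
      R ^ 2 < ((p : ℝ) - 1) / 2 →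
      ENNReal.ofReal (C * (R ^ 2 / n)) ≤ minimaxRisk n p q R := by
  -- `r` is small enough for a single pair of correlations `2 r` to fit into the budget `R₀`.
  obtain ⟨r, hr0, hr1, hr⟩ : ∃ r : ℝ, 0 < r ∧ r ≤ 1 / 4 ∧
      ∀ R, R₀ ≤ R → (q = 0 → 2 ≤ R) → 2 * (2 * r) ^ q ≤ R := by
    rcases hq.eq_or_lt with rfl | hq
    · exact ⟨1 / 4, by norm_num, le_rfl, fun R _ h => by simpa using h rfl⟩
    · refine ⟨min (1 / 4) ((R₀ / 2) ^ (1 / q) / 2), by positivity, min_le_left _ _,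
        fun R hR _ => ?_⟩
      have h1 : 2 * min (1 / 4) ((R₀ / 2) ^ (1 / q) / 2) ≤ (R₀ / 2) ^ (1 / q) := by
        linarith [min_le_right (1 / 4) ((R₀ / 2) ^ (1 / q) / 2)]
      have h2 := Real.rpow_le_rpow (by positivity) h1 hq.le
      rw [← Real.rpow_mul (by positivity), one_div_mul_cancel hq.ne', Real.rpow_one] at h2
      linarith
  refine ⟨r ^ 4 / 65536, by positivity, fun R hR hqR n p hn hRp => ?_⟩
  have hRpos : 0 < R := hR₀.trans_le hR
  have hn' : (1 : ℝ) ≤ n := by exact_mod_cast hn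
  -- `m` is the largest block size with `(2 m)² ≤ R`, or `1`.
  obtain ⟨m, hm, hmR, hmp⟩ : ∃ m : ℕ, R / 16 ≤ (m : ℝ) ^ 2 ∧
      ((m = 1 ∧ 2 * (2 * r) ^ q ≤ R) ∨ 4 * (m : ℝ) ^ 2 ≤ R) ∧ 2 * m ≤ p := by
    rcases lt_or_ge R 4 with h4 | h4
    · refine ⟨1, by norm_num; linarith, Or.inl ⟨rfl, hr R hR hqR⟩, ?_⟩
      have : (1 : ℝ) < p := by nlinarith
      have : 1 < p := by exact_mod_cast this
      omega
    · have hsq : 2 ≤ √R := Real.le_sqrt_of_sq_le (by linarith)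
      have hsR : √R ^ 2 = R := Real.sq_sqrt hRpos.le
      have hle : (⌊√R / 2⌋₊ : ℝ) ≤ √R / 2 := Nat.floor_le (by positivity)
      have hlt := Nat.lt_floor_add_one (√R / 2)
      have h1 : (1 : ℝ) ≤ ⌊√R / 2⌋₊ := by
        exact_mod_cast Nat.le_floor (by push_cast; linarith : ((1 : ℕ) : ℝ) ≤ √R / 2)
      refine ⟨⌊√R / 2⌋₊, by nlinarith, Or.inr (by nlinarith), ?_⟩
      have : ((2 * ⌊√R / 2⌋₊ : ℕ) : ℝ) ≤ p := by push_cast; nlinarith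
      exact_mod_cast this
  have hsn : √(n : ℝ) ^ 2 = n := Real.sq_sqrt (by linarith)
  have hsn1 : 1 ≤ √(n : ℝ) := Real.one_le_sqrt.2 hn'
  have ht2 : (r / (2 * √(n : ℝ))) ^ 2 = r ^ 2 / (4 * n) := by
    rw [div_pow, mul_pow, hsn]; norm_num
  have key := minimaxRisk_ge_of_twoBlock (n := n) hmp (t := r / (2 * √(n : ℝ))) hq hr0 hr1
    (by positivity) (div_le_self hr0.le (by linarith)) (by
      rw [ht2]
      have : (n : ℝ) * (r ^ 2 / (4 * n)) = r ^ 2 / 4 := by field_simp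
      rw [this]; nlinarith) hmR
  refine le_trans (ENNReal.ofReal_le_ofReal ?_) key
  rw [ht2]
  have h4 : R ^ 2 / 256 ≤ (m : ℝ) ^ 4 := by
    have := pow_le_pow_left₀ (by positivity) hm 2
    calc R ^ 2 / 256 = (R / 16) ^ 2 := by ring
      _ ≤ _ := this
      _ = _ := by ring
  calc r ^ 4 / 65536 * (R ^ 2 / n) = (R ^ 2 / 256) * (r ^ 4 / n) * (1 / 256) := by ring
    _ ≤ (m : ℝ) ^ 4 * (r ^ 4 / n) * (3 / 256) := by gcongr; norm_num
    _ = _ := by ring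

/-! ### The sparse rate: a random sparse row of correlations -/

section Star

open Matrix

variable {d : ℕ}

/-- The correlation matrix in which variable `0` has covariance `v` with the other variables, these
being uncorrelated among themselves. -/
def starCov (v : Fin d → ℝ) : Matrix (Fin (d + 1)) (Fin (d + 1)) ℝ :=
  of (Fin.cons (Fin.cons 1 v) fun i => Fin.cons (v i) (Pi.single i 1))

lemma latentCov_star (v : Fin d → ℝ) :
    latentCov (Fin.cons 0 fun i => Pi.single i 1) (Fin.cons 1 0) v = starCov v := by
  ext i j
  refine Fin.cases ?_ (fun i => ?_) i <;> refine Fin.cases ?_ (fun j => ?_) j <;>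
    simp [latentCov, starCov, Pi.single_apply, eq_comm]

lemma sum_offDiag_fin_succ (g : Fin (d + 1) × Fin (d + 1) → ℝ) :
    ∑ x ∈ Finset.univ.offDiag, g x = ∑ j, (g (0, Fin.succ j) + g (Fin.succ j, 0)) +
      ∑ x ∈ (Finset.univ : Finset (Fin d)).offDiag, g (Fin.succ x.1, Fin.succ x.2) := by
  have h : ∀ (s : ℕ) (g : Fin s × Fin s → ℝ), ∑ x ∈ Finset.univ.offDiag, g x =
      ∑ i, ∑ j, if i = j then 0 else g (i, j) := fun s g => by
    have : (Finset.univ : Finset (Fin s)).offDiag =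
        Finset.univ.filter fun x => ¬ x.1 = x.2 := by ext; simp
    rw [this, Finset.sum_filter, ← Finset.univ_product_univ, Finset.sum_product]
    simp only [ite_not]
  rw [h, h, Fin.sum_univ_succ]
  simp only [Fin.sum_univ_succ, Fin.succ_inj, Fin.succ_ne_zero, (Fin.succ_ne_zero _).symm, if_true,
    if_false, Finset.sum_add_distrib]
  ring

lemma offDiagQuad_starCov (v : Fin d → ℝ) : offDiagQuad (starCov v) = 2 * (v ⬝ᵥ v) := by
  rw [offDiagQuad, sum_offDiag_fin_succ, Finset.sum_eq_zero (s := Finset.offDiag _)]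
  · simp [starCov, dotProduct, Finset.mul_sum, sq, two_mul]
  · intro x hx
    have : x.2 ≠ x.1 := by simpa [eq_comm] using hx
    simp [starCov, this]

lemma offDiagSparsity_starCov (q : ℝ) (v : Fin d → ℝ) :
    offDiagSparsity q (starCov v) = 2 * ∑ j, if v j = 0 then 0 else |v j| ^ q := by
  rw [offDiagSparsity, sum_offDiag_fin_succ, Finset.sum_eq_zero (s := Finset.offDiag _)]
  · simp only [Finset.mul_sum, add_zero]
    exact Finset.sum_congr rfl fun j _ => by
      simp only [starCov, of_apply, Fin.cons_zero, Fin.cons_succ, two_mul]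
  · intro x hx
    have : x.2 ≠ x.1 := by simpa [eq_comm] using hx
    simp [starCov, this]

lemma starCov_apply_self (v : Fin d → ℝ) (i : Fin (d + 1)) : starCov v i i = 1 := by
  refine Fin.cases ?_ (fun i => ?_) i <;> simp [starCov]

variable {k B : ℕ}

/-- The support picked by `f : Fin k → Fin B`: one point in each of `k` disjoint groups of `B`
indices, the groups being laid out in `Fin d` by `e`. -/
def groupSupport (e : Fin k × Fin B ↪ Fin d) (f : Fin k → Fin B) : Finset (Fin d) :=
  Finset.univ.map ⟨fun i => e (i, f i), fun _ _ h => congrArg Prod.fst (e.injective h)⟩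

/-- The covariance vector with value `a` on `groupSupport e f`. -/
def sparseVec (e : Fin k × Fin B ↪ Fin d) (a : ℝ) (f : Fin k → Fin B) (j : Fin d) : ℝ :=
  if j ∈ groupSupport e f then a else 0

lemma sum_ite_groupSupport (e : Fin k × Fin B ↪ Fin d) (f : Fin k → Fin B) (g : Fin d → ℝ) :
    ∑ j, (if j ∈ groupSupport e f then g j else 0) = ∑ i, g (e (i, f i)) := by
  rw [Finset.sum_ite_mem, Finset.univ_inter, groupSupport, Finset.sum_map]
  rfl

lemma mem_groupSupport (e : Fin k × Fin B ↪ Fin d) (f g : Fin k → Fin B) (i : Fin k) :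
    e (i, f i) ∈ groupSupport e g ↔ f i = g i := by
  simp only [groupSupport, Finset.mem_map, Finset.mem_univ, true_and]
  constructor
  · rintro ⟨j, h⟩
    obtain ⟨rfl, h⟩ := Prod.mk.inj (e.injective h)
    exact h.symm
  · exact fun h => ⟨i, congrArg (fun b => e (i, b)) h.symm⟩

lemma sparseVec_dotProduct (e : Fin k × Fin B ↪ Fin d) (a : ℝ) (f g : Fin k → Fin B) :
    sparseVec e a f ⬝ᵥ sparseVec e a g = ∑ i, if f i = g i then a ^ 2 else 0 := by
  have : ∀ j, sparseVec e a f j * sparseVec e a g j =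
      if j ∈ groupSupport e f then (if j ∈ groupSupport e g then a ^ 2 else 0) else 0 := fun j => by
    simp only [sparseVec]; split_ifs <;> simp [sq]
  simp only [dotProduct, this]
  rw [sum_ite_groupSupport e f fun j => if j ∈ groupSupport e g then a ^ 2 else 0]
  simp only [mem_groupSupport]

lemma one_div_one_sub_le_exp {t : ℝ} (h0 : 0 ≤ t) (h : t ≤ 1 / 2) :
    1 / (1 - t) ≤ Real.exp (2 * t) := by
  have h1 : 0 < 1 - t := by linarith
  have : 1 / (1 - t) ≤ 2 * t + 1 := by
    rw [div_le_iff₀ h1]; nlinarith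
  exact this.trans (Real.add_one_le_exp _)

/-- Since the groups are chosen independently, the exponential moment of the overlap of two random
supports is a product. -/
lemma sum_prod_ite_le {E : ℝ} (hE : 0 ≤ E) (hB : 1 ≤ B) :
    ∑ f : Fin k → Fin B, ∑ g : Fin k → Fin B, ∏ i, (if f i = g i then E else 1) ≤
      Real.exp (k * E / B) * ((B : ℝ) ^ k) ^ 2 := by
  have hB' : (1 : ℝ) ≤ B := by exact_mod_cast hB
  have h1 : ∀ f : Fin k → Fin B, ∑ g : Fin k → Fin B, ∏ i, (if f i = g i then E else 1) =
      (E + (B - 1)) ^ k := fun f => by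
    have h := Finset.prod_univ_sum (fun _ : Fin k => (Finset.univ : Finset (Fin B)))
      (fun i b => if f i = b then E else 1)
    rw [Fintype.piFinset_univ] at h
    rw [← h]
    have h2 : ∀ i, ∑ b, (if f i = b then E else 1) = E + (B - 1) := fun i => by
      have : ∀ b, (if f i = b then E else 1) = 1 + if f i = b then E - 1 else 0 := fun b => by
        split_ifs <;> ring
      simp only [this, Finset.sum_add_distrib, Finset.sum_ite_eq, Finset.mem_univ, if_true,
        Finset.sum_const, Finset.card_univ, Fintype.card_fin, nsmul_eq_mul]
      ring
    simp [h2]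
  simp only [h1, Finset.sum_const, Finset.card_univ, Fintype.card_pi, Fintype.card_fin,
    Finset.prod_const, nsmul_eq_mul]
  have h3 : E + (B - 1) ≤ B * Real.exp (E / B) := by
    have := Real.add_one_le_exp (E / B)
    calc E + (B - 1) ≤ B * (E / B + 1) := by field_simp; linarith
      _ ≤ _ := by gcongr
  calc ((B ^ k : ℕ) : ℝ) * (E + (B - 1)) ^ k
      ≤ (B : ℝ) ^ k * (B * Real.exp (E / B)) ^ k := by
        push_cast
        gcongr
    _ = Real.exp (k * E / B) * ((B : ℝ) ^ k) ^ 2 := by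
        rw [mul_pow, ← Real.exp_nat_mul, mul_div_assoc]; ring

/-- Le Cam's bound for independence against a random row of `k` correlations equal to `a`. The
quantity in `hM` is the exponent in the bound for the second moment of the mixture. -/
lemma minimaxRisk_ge_of_star {n : ℕ} (hkB : k * B ≤ d) (hB : 1 ≤ B) {q R a : ℝ} (ha : 0 < a)
    (hka : k * a ^ 2 ≤ 1 / 2) (hR : 2 * (k * a ^ q) ≤ R)
    (hM : k * Real.exp (2 * n * a ^ 2) / B ≤ 16) :
    ENNReal.ofReal ((k * a ^ 2) ^ 2 * (1 / (4 * Real.exp 16))) ≤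
      minimaxRisk n (d + 1) q R := by
  have hne : Nonempty (Fin k → Fin B) := ⟨fun _ => ⟨0, hB⟩⟩
  obtain ⟨e⟩ : Nonempty (Fin k × Fin B ↪ Fin d) :=
    ⟨finProdFinEquiv.toEmbedding.trans (Fin.castLEEmb hkB)⟩
  have hdot : ∀ f g, sparseVec e a f ⬝ᵥ sparseVec e a g ≤ 1 / 2 := fun f g => by
    rw [sparseVec_dotProduct]
    calc _ ≤ ∑ _i : Fin k, a ^ 2 := by
          refine Finset.sum_le_sum fun i _ => ?_
          split_ifs
          · exact le_rfl
          · positivity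
      _ = k * a ^ 2 := by simp
      _ ≤ _ := hka
  have hdot0 : ∀ f g, 0 ≤ sparseVec e a f ⬝ᵥ sparseVec e a g := fun f g => by
    rw [sparseVec_dotProduct]
    exact Finset.sum_nonneg fun i _ => by split_ifs <;> positivity
  have hdots : ∀ f, sparseVec e a f ⬝ᵥ sparseVec e a f = k * a ^ 2 := fun f => by
    simp [sparseVec_dotProduct]
  have hv : ∀ f, sparseVec e a f ⬝ᵥ sparseVec e a f < 1 := fun f => by linarith [hdot f f]
  have haq : 0 < a ^ q := Real.rpow_pos_of_pos ha q
  have hsp : ∀ f, offDiagSparsity q (starCov (sparseVec e a f)) ≤ R := fun f => by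
    rw [offDiagSparsity_starCov]
    have : ∀ j, (if sparseVec e a f j = 0 then 0 else |sparseVec e a f j| ^ q) =
        if j ∈ groupSupport e f then a ^ q else 0 := fun j => by
      simp only [sparseVec]
      split_ifs <;> simp_all [abs_of_pos]
    simp only [this]
    rw [sum_ite_groupSupport e f fun _ => a ^ q]
    simpa using hR
  have hR0 : 0 ≤ R := le_trans (by positivity) hR
  have key := minimaxRisk_ge_of_tilt (n := n) (q := q) (R := R)
    (Fin.cons 0 fun i => Pi.single i 1 : Fin (d + 1) → Fin d → ℝ) (Fin.cons 1 0)
    (v := sparseVec e a) hv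
    ⟨posSemidef_latentCov (by simp) _ _, by
      rw [latentCov_star, offDiagSparsity_starCov]; simpa using hR0,
      by rw [latentCov_star]; exact starCov_apply_self _⟩
    (fun f => ⟨posSemidef_latentCov (hv f) _ _, by rw [latentCov_star]; exact hsp f,
      by rw [latentCov_star]; exact starCov_apply_self _⟩)
    (Δ := 2 * (k * a ^ 2)) (by positivity)
    (fun f => by
      rw [latentCov_star, latentCov_star, offDiagQuad_starCov, offDiagQuad_starCov, hdots]; simp)
    (M := Real.exp 16) (Real.one_le_exp (by norm_num)) (by
      calc ∑ f, ∑ g, (1 / (1 - sparseVec e a f ⬝ᵥ sparseVec e a g)) ^ n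
          ≤ ∑ f : Fin k → Fin B, ∑ g : Fin k → Fin B,
            ∏ i, (if f i = g i then Real.exp (2 * n * a ^ 2) else 1) := by
            refine Finset.sum_le_sum fun f _ => Finset.sum_le_sum fun g _ => ?_
            have h1 : 0 ≤ 1 / (1 - sparseVec e a f ⬝ᵥ sparseVec e a g) :=
              one_div_nonneg.2 (by linarith [hdot f g])
            refine (pow_le_pow_left₀ h1
              (one_div_one_sub_le_exp (hdot0 f g) (hdot f g)) n).trans_eq ?_
            rw [sparseVec_dotProduct, ← Real.exp_nat_mul, Finset.mul_sum, Finset.mul_sum,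
              Real.exp_sum]
            refine Finset.prod_congr rfl fun i _ => ?_
            split_ifs
            · congr 1; ring
            · simp
        _ ≤ Real.exp (k * Real.exp (2 * n * a ^ 2) / B) * ((B : ℝ) ^ k) ^ 2 :=
            sum_prod_ite_le (Real.exp_pos _).le hB
        _ ≤ Real.exp 16 * (Fintype.card (Fin k → Fin B) : ℝ) ^ 2 := by
            simp only [Fintype.card_pi, Fintype.card_fin, Finset.prod_const, Finset.card_univ]
            push_cast
            gcongr)
  refine le_trans (ENNReal.ofReal_le_ofReal (le_of_eq ?_)) key
  field_simp
  ring

end Star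

lemma rpow_sq_eq {a : ℝ} (ha : 0 ≤ a) (q : ℝ) : (a ^ q) ^ 2 = (a ^ 2) ^ q := by
  rw [← Real.rpow_natCast, ← Real.rpow_mul ha, mul_comm, Real.rpow_mul ha, Real.rpow_natCast]

/-- Choice of the magnitude `a` and the number `k` of nonzero entries of the sparse row. The
magnitude is `√u`, capped by `(R / 2) ^ (1 / q)`, so that one entry fits into the budget `R`, and by
`√2⁻¹`, so that one entry is compatible with positive semidefiniteness; if one of the caps is
active, then a single entry is used. -/
lemma exists_entry_size {q R u : ℝ} (hq0 : 0 ≤ q) (hR : 0 < R) (hqR : q = 0 → 2 ≤ R)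
    (hu0 : 0 < u) :
    ∃ (a : ℝ) (k : ℕ), 0 < a ∧ 1 ≤ k ∧ a ^ 2 ≤ u ∧ k * (2 * a ^ 2) ≤ 1 ∧ k * (2 * a ^ q) ≤ R ∧
      (k = 1 ∨ a ^ 2 = u) ∧ min (1 / 16) (2 ^ (-(4 / q)) / 4) *
        min (min (R ^ 2 * u ^ (2 - q)) (R ^ (4 / q))) 1 ≤ (k * a ^ 2) ^ 2 := by
  set c₁ : ℝ := (R / 2) ^ (1 / q) with hc₁
  have hc₁q : q ≠ 0 → c₁ ^ q = R / 2 := fun h => by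
    rw [hc₁, ← Real.rpow_mul (by positivity), one_div_mul_cancel h, Real.rpow_one]
  have hsqrt2 : ((√2)⁻¹ : ℝ) ^ 2 = 1 / 2 := by
    rw [inv_pow, Real.sq_sqrt (by norm_num)]; norm_num
  have hsqrtu : √u ^ 2 = u := Real.sq_sqrt hu0.le
  obtain ⟨a, ha0, hau, hac, ha2, hcases⟩ : ∃ a : ℝ, 0 < a ∧ a ≤ √u ∧ a ≤ c₁ ∧ a ≤ (√2)⁻¹ ∧
      (a = √u ∨ a = c₁ ∨ a = (√2)⁻¹) := by
    refine ⟨min (min √u c₁) (√2)⁻¹, by positivity, (min_le_left _ _).trans (min_le_left _ _),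
      (min_le_left _ _).trans (min_le_right _ _), min_le_right _ _, ?_⟩
    rcases min_choice (min √u c₁) (√2)⁻¹ with h | h
    · rcases min_choice √u c₁ with h' | h'
      · exact Or.inl (h.trans h')
      · exact Or.inr (Or.inl (h.trans h'))
    · exact Or.inr (Or.inr h)
  replace hau : a ^ 2 ≤ u := (pow_le_pow_left₀ ha0.le hau 2).trans_eq hsqrtu
  replace ha2 : a ^ 2 ≤ 1 / 2 := (pow_le_pow_left₀ ha0.le ha2 2).trans_eq hsqrt2
  replace hcases : a ^ 2 = u ∨ (q ≠ 0 ∧ a = c₁) ∨ a ^ 2 = 1 / 2 := by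
    rcases hcases with h | h | h
    · exact Or.inl (by rw [h, hsqrtu])
    · refine Or.inr (Or.inl ⟨fun hq => ?_, h⟩)
      -- For `q = 0` the exponent `1 / q` is `0`, so that `c₁ = 1` and this cap is never active.
      have : a = 1 := by rw [h, hc₁, hq]; simp
      rw [this] at ha2
      norm_num at ha2
    · exact Or.inr (Or.inr (by rw [h, hsqrt2]))
  have haq0 : 0 < a ^ q := Real.rpow_pos_of_pos ha0 q
  have haq : 2 * a ^ q ≤ R := by
    rcases eq_or_ne q 0 with h | h
    · rw [h, Real.rpow_zero]; linarith [hqR h]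
    · have := Real.rpow_le_rpow ha0.le hac hq0
      rw [hc₁q h] at this
      linarith
  set y : ℝ := min (R / (2 * a ^ q)) (1 / (2 * a ^ 2)) with hy
  have hy1 : 1 ≤ y := by
    refine le_min ?_ ?_
    · rw [le_div_iff₀ (by positivity)]; linarith
    · rw [le_div_iff₀ (by positivity)]; linarith
  have hk1 : 1 ≤ ⌊y⌋₊ := Nat.le_floor (by simpa using hy1)
  have hky : (⌊y⌋₊ : ℝ) ≤ y := Nat.floor_le (by linarith)
  have hk1' : (1 : ℝ) ≤ ⌊y⌋₊ := by exact_mod_cast hk1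
  have hyk : y ≤ 2 * ⌊y⌋₊ := by linarith [Nat.lt_floor_add_one y]
  have hk_or : ⌊y⌋₊ = 1 ∨ a ^ 2 = u := by
    have key : y ≤ 1 → ⌊y⌋₊ = 1 := fun h => by rw [le_antisymm h hy1]; simp
    rcases hcases with h | ⟨hq, h⟩ | h
    · exact Or.inr h
    · refine Or.inl (key ((min_le_left _ _).trans_eq ?_))
      rw [h, hc₁q hq]; field_simp
    · refine Or.inl (key ((min_le_right _ _).trans_eq ?_))
      rw [h]; norm_num
  refine ⟨a, ⌊y⌋₊, ha0, hk1, hau, (le_div_iff₀ (by positivity)).1 (hky.trans (min_le_right _ _)),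
    (le_div_iff₀ (by positivity)).1 (hky.trans (min_le_left _ _)), hk_or, ?_⟩
  generalize ⌊y⌋₊ = k at *
  set c : ℝ := min (1 / 16) (2 ^ (-(4 / q)) / 4) with hc
  have hc0 : 0 ≤ c := by positivity
  have hc16 : c ≤ 1 / 16 := min_le_left _ _
  have hone : 1 / 4 ≤ k * a ^ 2 →
      c * min (min (R ^ 2 * u ^ (2 - q)) (R ^ (4 / q))) 1 ≤ (k * a ^ 2) ^ 2 := fun h =>
    calc _ ≤ c * 1 := mul_le_mul_of_nonneg_left (min_le_right _ _) hc0
      _ ≤ (1 / 4) ^ 2 := by linarith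
      _ ≤ _ := pow_le_pow_left₀ (by norm_num) h 2
  rcases hcases with h | ⟨hq, h⟩ | h
  · rcases min_choice (R / (2 * a ^ q)) (1 / (2 * a ^ 2)) with h' | h'
    · have hk4 : R * u ≤ 4 * (k * a ^ 2) * a ^ q := by
        rw [hy, h', div_le_iff₀ (by positivity)] at hyk
        rw [h]
        nlinarith
      have hk5 : R ^ 2 * u ^ 2 ≤ 16 * (k * a ^ 2) ^ 2 * u ^ q := by
        have := pow_le_pow_left₀ (by positivity) hk4 2
        rw [mul_pow, mul_pow, mul_pow, rpow_sq_eq ha0.le, h] at this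
        rw [h]
        linarith
      have hk6 : R ^ 2 * u ^ (2 - q) ≤ 16 * (k * a ^ 2) ^ 2 := by
        rw [Real.rpow_sub hu0, Real.rpow_ofNat, ← mul_div_assoc,
          div_le_iff₀ (Real.rpow_pos_of_pos hu0 q)]
        exact hk5
      calc _ ≤ 1 / 16 * (R ^ 2 * u ^ (2 - q)) :=
            mul_le_mul hc16 ((min_le_left _ _).trans (min_le_left _ _)) (by positivity)
              (by norm_num)
        _ ≤ _ := by linarith
    · apply hone
      rw [hy, h', div_le_iff₀ (by positivity)] at hyk
      linarith
  · have hcq : c ≤ 2 ^ (-(4 / q)) := by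
      have : (0 : ℝ) < 2 ^ (-(4 / q)) := by positivity
      linarith [min_le_right (1 / 16 : ℝ) (2 ^ (-(4 / q)) / 4)]
    calc _ ≤ 2 ^ (-(4 / q)) * R ^ (4 / q) :=
          mul_le_mul hcq ((min_le_left _ _).trans (min_le_right _ _)) (by positivity)
            (by positivity)
      _ = (R / 2) ^ (4 / q) := by
          rw [Real.div_rpow hR.le (by norm_num), Real.rpow_neg (by norm_num)]
          field_simp
      _ = (1 * a ^ 2) ^ 2 := by
          rw [one_mul, ← pow_mul, h, hc₁, ← Real.rpow_natCast, ← Real.rpow_mul (by positivity)]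
          congr 1; push_cast; ring
      _ ≤ _ := by gcongr
  · apply hone
    rw [h]
    linarith

/-- The sparse row attaining the rate. With `x = d / (R² n^q)` and `u = log (x + 1) / (2 n)`, the
factor `exp (2 n a²)` is at most `x + 1`, and `k ≤ R / (2 a^q)` makes `k²` at most of order
`R² n^q = d / x` when `a² = u`. -/
lemma exists_sparse_row_parameters {q R : ℝ} (hq0 : 0 ≤ q) (hq2 : q < 2) (hR : 0 < R)
    (hqR : q = 0 → 2 ≤ R) {n d : ℕ} (hn : 1 ≤ n) (hRd : R ^ 2 < d * (n : ℝ) ^ (-q) / 2) :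
    ∃ (a : ℝ) (k : ℕ), 0 < a ∧ 1 ≤ k ∧ k ≤ d ∧ k * a ^ 2 ≤ 1 / 2 ∧ 2 * (k * a ^ q) ≤ R ∧
      k ^ 2 * Real.exp (2 * n * a ^ 2) ≤ 8 * d ∧
      min (1 / 16) (2 ^ (-(4 / q)) / 4) * sparseRate n (d + 1) q R ≤ (k * a ^ 2) ^ 2 := by
  have hn' : (1 : ℝ) ≤ n := by exact_mod_cast hn
  set N : ℝ := (n : ℝ) ^ q with hN
  have hN1 : 1 ≤ N := Real.one_le_rpow hn' hq0
  have hRN : 2 * (R ^ 2 * N) < d := by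
    rw [Real.rpow_neg (by positivity), ← hN] at hRd
    have : d * N⁻¹ / 2 * (2 * N) = d := by field_simp
    nlinarith
  have hR2 : 0 < R ^ 2 := by positivity
  have hd : (1 : ℝ) ≤ d := by
    have : (0 : ℝ) < d := by nlinarith
    exact_mod_cast this
  set x : ℝ := d / (R ^ 2 * N) with hx
  have hx2 : 2 < x := by rw [hx, lt_div_iff₀ (by positivity)]; linarith
  have hxd : R ^ 2 * N * x = d := by rw [hx]; field_simp
  have hL : 1 ≤ Real.log (x + 1) := by
    rw [Real.le_log_iff_exp_le (by linarith)]
    linarith [Real.exp_one_lt_d9]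
  set u : ℝ := Real.log (x + 1) / (2 * n) with hu
  have hun : 2 * n * u = Real.log (x + 1) := by rw [hu]; field_simp
  have hu0 : 0 < u := by positivity
  have hrate : sparseRate n (d + 1) q R = min (min (R ^ 2 * u ^ (2 - q)) (R ^ (4 / q))) 1 := by
    simp [sparseRate, hu, hx, hN]
  obtain ⟨a, k, ha0, hk1, hau, hka, hkR, hk_or, hkrate⟩ := exists_entry_size hq0 hR hqR hu0
  have hk1' : (1 : ℝ) ≤ k := by exact_mod_cast hk1
  have haq0 : 0 < a ^ q := Real.rpow_pos_of_pos ha0 q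
  have hE : Real.exp (2 * n * a ^ 2) ≤ 2 * x :=
    calc Real.exp (2 * n * a ^ 2) ≤ Real.exp (2 * n * u) :=
          Real.exp_le_exp.2 (mul_le_mul_of_nonneg_left hau (by positivity))
      _ = x + 1 := by rw [hun, Real.exp_log (by linarith)]
      _ ≤ 2 * x := by linarith
  have hkR2 : (k : ℝ) ^ 2 * (4 * (a ^ 2) ^ q) ≤ R ^ 2 := by
    have := pow_le_pow_left₀ (by positivity) hkR 2
    rw [mul_pow, mul_pow, rpow_sq_eq ha0.le] at this
    linarith
  have hkN : a ^ 2 = u → (k : ℝ) ^ 2 ≤ R ^ 2 * N := fun h => by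
    have h1 : 1 / 4 ≤ u ^ q * N := by
      calc (1 / 4 : ℝ) = (1 / 2) ^ (2 : ℝ) := by norm_num
        _ ≤ (1 / 2) ^ q := Real.rpow_le_rpow_of_exponent_ge (by norm_num) (by norm_num) hq2.le
        _ ≤ (u * n) ^ q := Real.rpow_le_rpow (by norm_num) (by linarith) hq0
        _ = u ^ q * N := Real.mul_rpow hu0.le (by positivity)
    rw [h] at hkR2
    calc (k : ℝ) ^ 2 = k ^ 2 * (4 * (1 / 4)) := by ring
      _ ≤ k ^ 2 * (4 * (u ^ q * N)) := by gcongr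
      _ = k ^ 2 * (4 * u ^ q) * N := by ring
      _ ≤ R ^ 2 * N := by gcongr
  refine ⟨a, k, ha0, hk1, ?_, by linarith, by linarith, ?_, hrate ▸ hkrate⟩
  · rcases hk_or with h | h
    · rw [h]; exact_mod_cast hd
    · have := hkN h
      have : (k : ℝ) ≤ d := by nlinarith
      exact_mod_cast this
  · rcases hk_or with h | h
    · rw [h, Nat.cast_one, one_pow, one_mul]
      rcases le_or_gt 1 (R ^ 2 * N) with h1 | h1
      · nlinarith
      -- Here `q ≠ 0`, and the budget alone forces `n a² ≤ 1`.
      · have hq : q ≠ 0 := fun hq => by nlinarith [hqR hq]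
        have hna : n * a ^ 2 ≤ 1 := by
          by_contra! hcon
          have h2 := Real.one_lt_rpow hcon (lt_of_le_of_ne hq0 hq.symm)
          rw [Real.mul_rpow (by positivity) (by positivity), ← hN] at h2
          rw [h, Nat.cast_one] at hkR2
          nlinarith
        have h2 : Real.exp (2 * n * a ^ 2) ≤ 8 :=
          calc Real.exp (2 * n * a ^ 2) ≤ Real.exp (1 + 1) := Real.exp_le_exp.2 (by linarith)
            _ = Real.exp 1 * Real.exp 1 := Real.exp_add 1 1
            _ ≤ 8 := by nlinarith [Real.exp_one_lt_d9, Real.exp_pos 1]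
        linarith
    · calc (k : ℝ) ^ 2 * Real.exp (2 * n * a ^ 2) ≤ R ^ 2 * N * (2 * x) :=
            mul_le_mul (hkN h) hE (Real.exp_pos _).le (by positivity)
        _ = 2 * d := by linarith
        _ ≤ 8 * d := by linarith

/-- The minimax risk is at least of the order of the sparse part of the rate. -/
lemma exists_sparse_lower_bound {q : ℝ} (hq0 : 0 ≤ q) (hq2 : q < 2) :
    ∃ C : ℝ, 0 < C ∧ ∀ R : ℝ, 0 < R → (q = 0 → 2 ≤ R) → ∀ n p : ℕ, 1 ≤ n →
      R ^ 2 < ((p : ℝ) - 1) * (n : ℝ) ^ (-q) / 2 →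
      ENNReal.ofReal (C * sparseRate n p q R) ≤ minimaxRisk n p q R := by
  refine ⟨min (1 / 16) (2 ^ (-(4 / q)) / 4) * (1 / (4 * Real.exp 16)), by positivity,
    fun R hR hqR n p hn hRp => ?_⟩
  obtain ⟨d, rfl⟩ : ∃ d, p = d + 1 := by
    refine Nat.exists_eq_succ_of_ne_zero ?_
    rintro rfl
    have : 0 < (n : ℝ) ^ (-q) := Real.rpow_pos_of_pos (by exact_mod_cast hn) _
    simp only [Nat.cast_zero, zero_sub] at hRp
    nlinarith [sq_nonneg R]
  rw [Nat.cast_add_one, add_sub_cancel_right] at hRp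
  obtain ⟨a, k, ha, hk1, hkd, hka, hkR, hkE, hrate⟩ :=
    exists_sparse_row_parameters hq0 hq2 hR hqR hn hRp
  have hB : 1 ≤ d / k := (Nat.one_le_div_iff hk1).2 hkd
  have hk : (1 : ℝ) ≤ k := by exact_mod_cast hk1
  have hB' : (1 : ℝ) ≤ (d / k : ℕ) := by exact_mod_cast hB
  have hdB : (d : ℝ) ≤ 2 * (k * (d / k : ℕ)) := by
    have h1 : d < k * (d / k) + k := Nat.lt_mul_div_succ d hk1 |>.trans_eq (by ring)
    have h2 : k ≤ k * (d / k) := Nat.le_mul_of_pos_right k hB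
    exact_mod_cast (by omega : d ≤ 2 * (k * (d / k)))
  refine le_trans (ENNReal.ofReal_le_ofReal ?_) (minimaxRisk_ge_of_star (n := n) (B := d / k)
    (Nat.mul_div_le d k) hB ha hka hkR ?_)
  · calc _ = min (1 / 16) (2 ^ (-(4 / q)) / 4) * sparseRate n (d + 1) q R
          * (1 / (4 * Real.exp 16)) := by ring
      _ ≤ _ := by gcongr
  · rw [div_le_iff₀ (by linarith)]
    refine le_of_mul_le_mul_left ?_ (by linarith : (0 : ℝ) < k)
    nlinarith

end SparseCov

theorem theorem3p2 (q : ℝ) (hq0 : 0 ≤ q) (hq2 : q < 2) :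
    (∀ R₀ : ℝ, 0 < R₀ → ∃ C₃ : ℝ, 0 < C₃ ∧
      ∀ R : ℝ, R₀ ≤ R → (q = 0 → 2 ≤ R) → ∀ n p : ℕ,
        2 * Real.log (p : ℝ) < (n : ℝ) →
        R ^ 2 < ((p : ℝ) - 1) * (n : ℝ) ^ (-q) / 2 →
        ENNReal.ofReal (C₃ * SparseCov.rate n p q R) ≤ SparseCov.minimaxRisk n p q R) ∧
    (∃ C₃ : ℝ, 0 < C₃ ∧
      ∀ R : ℝ, 0 < R → (q = 0 → 2 ≤ R) → ∀ n p : ℕ,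
        2 * Real.log (p : ℝ) < (n : ℝ) →
        R ^ 2 < ((p : ℝ) - 1) * (n : ℝ) ^ (-q) / 2 →
        ENNReal.ofReal (C₃ * SparseCov.sparseRate n p q R) ≤ SparseCov.minimaxRisk n p q R) := by
  have hn : ∀ n p : ℕ, 2 * Real.log (p : ℝ) < (n : ℝ) → 1 ≤ n := fun n p h => by
    have h1 : 0 ≤ Real.log (p : ℝ) := Real.log_natCast_nonneg p
    have h2 : (0 : ℝ) < n := by linarith
    exact_mod_cast h2
  obtain ⟨C, hC, hsparse⟩ := SparseCov.exists_sparse_lower_bound hq0 hq2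
  refine ⟨fun R₀ hR₀ => ?_, C, hC, fun R hR hqR n p hnp hRp =>
    hsparse R hR hqR n p (hn n p hnp) hRp⟩
  obtain ⟨C', hC', hpar⟩ := SparseCov.exists_parametric_lower_bound hq0 hR₀
  refine ⟨min C C', lt_min hC hC', fun R hR hqR n p hnp hRp => ?_⟩
  have hn1 : (1 : ℝ) ≤ n := by exact_mod_cast hn n p hnp
  have hRpos : 0 < R := hR₀.trans_le hR
  rcases le_total (R ^ 2 / (n : ℝ)) (SparseCov.sparseRate n p q R) with h | h
  · refine le_trans (ENNReal.ofReal_le_ofReal ?_) (hsparse R hRpos hqR n p (hn n p hnp) hRp)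
    rw [SparseCov.rate, max_eq_right h]
    exact mul_le_mul_of_nonneg_right (min_le_left _ _) (le_trans (by positivity) h)
  · have hp : R ^ 2 < ((p : ℝ) - 1) / 2 := by
      have h1 : (n : ℝ) ^ (-q) ≤ 1 := Real.rpow_le_one_of_one_le_of_nonpos hn1 (by linarith)
      have h2 : 0 < (n : ℝ) ^ (-q) := Real.rpow_pos_of_pos (by linarith) _
      nlinarith [sq_nonneg R]
    refine le_trans (ENNReal.ofReal_le_ofReal ?_) (hpar R hR hqR n p (hn n p hnp) hp)
    rw [SparseCov.rate, max_eq_left h]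
    exact mul_le_mul_of_nonneg_right (min_le_right _ _) (by positivity)
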